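/- **Notation.** Let $N,k\ge 1$ be integers, $Q:=(-1/2,1/2)^N$, and for $l\ge 1$ let $\mathbb M^{N^l}$ be the space of real tensors of format $N\times\cdots\times N$ ($l$ factors) with the Euclidean norm, so that $\mathbb M^{N^1}=\mathbb R^N$. A first order operator is $\mathscr B=\sum_{i=1}^N B^i\partial_i$ with constant coefficients, where each $B^i$ is a linear map $\mathbb M^{N^l}\to\mathbb M^{N^{l+1}}$; it maps $\mathbb M^{N^l}$-valued distributions on $Q$ to $\mathbb M^{N^{l+1}}$-valued ones, and $\|\mathscr B\|_{\ell^\infty}:=\sum_{i}\|B^i\|$, with $\|B^i\|$ the Euclidean norm of the array of entries of $B^i$. $\mathcal M_b(Q;F)$ is the space of $F$-valued bounded Radon measures on $Q$, with the total variation norm $|\mu|_{\mathcal M_b}=|\mu|(Q)$; we put $|T|_{\mathcal M_b}=+\infty$ for a distribution $T$ that is not in $\mathcal M_b$. Let $$BV_{\mathscr B}(Q;\mathbb M^{N^l}):=\{v\in L^1(Q;\mathbb M^{N^l}):\mathscr Bv\in\mathcal M_b(Q;\mathbb M^{N^{l+1}})\},\qquad \|v\|_{BV_{\mathscr B}}:=\|v\|_{L^1}+|\mathscr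 Bv|_{\mathcal M_b}.$$ *Basic assumption on $\mathscr B$:* (1) $BV_{\mathscr B}$ is a Banach space; (2) for every $v\in BV_{\mathscr B}$ there are $w_j\in C^\infty(\overline Q;\mathbb M^{N^l})$ with $w_j\to v$ in $L^1$ and $|\mathscr Bw_j|_{\mathcal M_b}\to|\mathscr Bv|_{\mathcal M_b}$; (3) the injection $BV_{\mathscr B}\to L^1$ is compact. $\Pi_l$ is the class of all $\mathscr B$ as above that satisfy the basic assumption and for which the null-space $\{v\in L^1(Q;\mathbb M^{N^l}):\mathscr Bv=0\}$ is finite dimensional. *Compactness assumption on a collection $\mathcal S$ of operators (acting on $\mathbb M^{N^l}$-valued distributions):* whenever $\mathscr B_j\in\mathcal S$ satisfy the basic assumption and $v_j\in BV_{\mathscr B_j}$ ($j\in\mathbb N$) are such that $\sup_j\big(\|\mathscr B_j\|_{\ell^\infty}+\|v_j\|_{BV_{\mathscr B_j}}\big)<\infty$, there are a first order operator $\mathscr B'$ and $v'\in BV_{\mathscr B'}$ such that, along a subsequence, $v_j\to v'$ strongly in $L^1$ and $\mathscr B_jv_j\rightharpoonup\mathscr B'v'$ weakly$^*$ in $\mathcal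 M_b$. For $\mathscr B[k]=(\mathscr B^0,\dots,\mathscr B^{k-1})$, where $\mathscr B^l$ maps $\mathbb M^{N^{l+1}}$-valued to $\mathbb M^{N^{l+2}}$-valued distributions, for $\alpha=(\alpha_0,\dots,\alpha_k)\in(0,\infty)^{k+1}$ and $u\in L^1(Q)$, let $$PGV^{k+1}_{\alpha,\mathscr B[k]}(u):=\inf\Big\{\alpha_0|Du-v_0|_{\mathcal M_b}+\sum_{l=1}^{k-1}\alpha_l|v_l-\mathscr B^{l-1}v_{l-1}|_{\mathcal M_b}+\alpha_k|\mathscr B^{k-1}v_{k-1}|_{\mathcal M_b}:\ v_l\in BV_{\mathscr B^l}(Q;\mathbb M^{N^{l+1}}),\ 0\le l\le k-1\Big\}.$$ **Proposition.** Let $u\in BV(Q)$. Let $\mathscr B_n[k]=(\mathscr B_n^0,\dots,\mathscr B_n^{k-1})\in\Pi_1\times\Pi_2\times\cdots\times\Pi_k$ and $\alpha_n\in(0,\infty)^{k+1}$, $n\in\mathbb N$, be such that $\|\mathscr B_n^l-\mathscr B^l\|_{\ell^\infty}\to0$ for each $l=0,\dots,k-1$, where $\mathscr B[k]=(\mathscr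 B^0,\dots,\mathscr B^{k-1})$ is a $k$-tuple of first order operators, and $\alpha_n\to\alpha\in(0,\infty)^{k+1}$. Assume that for each $l=0,\dots,k-1$ the collection $\{\mathscr B_n^l:n\in\mathbb N\}$ satisfies the compactness assumption. Then all the numbers $PGV^{k+1}_{\alpha_n,\mathscr B_n[k]}(u)$ and $PGV^{k+1}_{\alpha,\mathscr B[k]}(u)$ are finite, and $$\lim_{n\to\infty}PGV^{k+1}_{\alpha_n,\mathscr B_n[k]}(u)=PGV^{k+1}_{\alpha,\mathscr B[k]}(u).$$ -/

import Mathlib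

open MeasureTheory Filter Topology TopologicalSpace
open scoped ENNReal NNReal Distributions LineDeriv ContDiff ZeroAtInfty

namespace PGV

/-! ### Tensors, the cube, Lebesgue spaces -/

/-- The Euclidean space `ℝ^N`. -/
abbrev Pt (N : ℕ) : Type := EuclideanSpace ℝ (Fin N)

/-- `𝕄^{N^l}`: real tensors of format `N × ⋯ × N` (`l` factors), with the Euclidean norm.
For `l = 1` these are the vectors of `ℝ^N`, for `l = 2` the `N × N` matrices. -/
abbrev Tens (N l : ℕ) : Type := EuclideanSpace ℝ (Fin l → Fin N)

/-- The unit open cube `Q = (-1/2, 1/2)^N`. -/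
def cube (N : ℕ) : Opens (Pt N) where
  carrier := {x | ∀ i, x i ∈ Set.Ioo (-(1 / 2) : ℝ) (1 / 2)}
  is_open' := by
    have h : {x : Pt N | ∀ i, x i ∈ Set.Ioo (-(1 / 2) : ℝ) (1 / 2)} =
        ⋂ i, (fun x : Pt N => x i) ⁻¹' Set.Ioo (-(1 / 2) : ℝ) (1 / 2) := by
      ext x; simp
    rw [h]
    exact isOpen_iInter_of_finite fun i => isOpen_Ioo.preimage (by fun_prop)

/-- Lebesgue measure on `Q`. -/
noncomputable abbrev volQ (N : ℕ) : Measure (Pt N) := volume.restrict (cube N : Set (Pt N))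

/-- `L¹(Q; F)`. -/
abbrev L1Q (N : ℕ) (F : Type*) [NormedAddCommGroup F] : Type _ := Lp F 1 (volQ N)

/-- The `i`-th vector of the standard basis of `ℝ^N`. -/
noncomputable def basisVec {N : ℕ} (i : Fin N) : Pt N := EuclideanSpace.single i 1

/-- The `i`-th vector of the standard basis of `ℝ^N`, seen as a tensor of order one. -/
noncomputable def basisTens {N : ℕ} (i : Fin N) : Tens N 1 :=
  EuclideanSpace.single (fun _ => i) 1

/-! ### Distributions on `Q` defined by `L¹` functions -/

theorem locallyIntegrableOn_L1Q {N : ℕ} {F : Type*} [NormedAddCommGroup F] (v : L1Q N F) :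
    LocallyIntegrableOn (v : Pt N → F) (cube N : Set (Pt N)) (volQ N) :=
  (L1.integrable_coeFn v).locallyIntegrable.locallyIntegrableOn _

section Distr

variable {N : ℕ} {F : Type*} [NormedAddCommGroup F] [NormedSpace ℝ F]

theorem integrable_test_smul (ψ : 𝓓(cube N, ℝ)) (v : L1Q N F) :
    Integrable (fun x => ψ x • v x) (volQ N) :=
  TestFunction.integrable_bilin (ContinuousLinearMap.lsmul ℝ ℝ) (locallyIntegrableOn_L1Q v) ψ

/-- The distribution `ψ ↦ ∫_Q ψ v dx` attached to `v ∈ L¹(Q; F)`. -/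
noncomputable def distrOfL1 (v : L1Q N F) : 𝓓'(cube N, F) :=
  (TestFunction.integralAgainstBilinCLM (ContinuousLinearMap.lsmul ℝ ℝ) (volQ N) (v : Pt N → F) :
    𝓓(cube N, ℝ) →L[ℝ] F)

theorem distrOfL1_apply (v : L1Q N F) (ψ : 𝓓(cube N, ℝ)) :
    distrOfL1 v ψ = ∫ x in (cube N : Set (Pt N)), ψ x • v x :=
  TestFunction.integralAgainstBilinCLM_eq_integral (locallyIntegrableOn_L1Q v)

/-- The embedding of `L¹(Q; F)` into the distributions on `Q`. -/
noncomputable def toDistr : L1Q N F →ₗ[ℝ] 𝓓'(cube N, F) where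
  toFun := distrOfL1
  map_add' v w := by
    ext ψ
    change distrOfL1 (v + w) ψ = distrOfL1 v ψ + distrOfL1 w ψ
    rw [distrOfL1_apply, distrOfL1_apply, distrOfL1_apply,
      ← integral_add (integrable_test_smul ψ v) (integrable_test_smul ψ w)]
    refine integral_congr_ae ?_
    filter_upwards [Lp.coeFn_add v w] with x hx
    rw [hx, Pi.add_apply, smul_add]
  map_smul' c v := by
    ext ψ
    change distrOfL1 (c • v) ψ = c • distrOfL1 v ψ
    rw [distrOfL1_apply, distrOfL1_apply, ← integral_smul]
    refine integral_congr_ae ?_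
    filter_upwards [Lp.coeFn_smul c v] with x hx
    rw [hx, Pi.smul_apply, smul_comm]

theorem toDistr_apply (v : L1Q N F) (ψ : 𝓓(cube N, ℝ)) :
    toDistr v ψ = ∫ x in (cube N : Set (Pt N)), ψ x • v x :=
  distrOfL1_apply v ψ

/-! ### Bounded Radon measures on `Q` -/

/-- The distribution `T` is the bounded Radon measure `μ` on `Q`: the vector measure `μ` has finite
total variation and `T ψ = ∫_Q ψ dμ` for every test function `ψ`. -/
def IsRepresentedBy (T : 𝓓'(cube N, F)) (μ : VectorMeasure (cube N) F) : Prop :=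
  IsFiniteMeasure μ.variation ∧ ∀ ψ : 𝓓(cube N, ℝ), T ψ = ∫ᵛ x, ψ x ∂•μ

/-- `T ∈ 𝓜_b(Q; F)`. -/
def IsBoundedMeasure (T : 𝓓'(cube N, F)) : Prop :=
  ∃ μ : VectorMeasure (cube N) F, IsRepresentedBy T μ

/-- `|T|_{𝓜_b(Q; F)}`: the total variation `|μ|(Q)` of the (unique) bounded Radon measure `μ` equal
to `T`, and `+∞` if `T` is not a bounded Radon measure. -/
noncomputable def measureNorm (T : 𝓓'(cube N, F)) : ℝ≥0∞ :=
  ⨅ (μ : VectorMeasure (cube N) F) (_ : IsRepresentedBy T μ), μ.variation Set.univ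

/-- Weak-star convergence `T n ⇀* T` in `𝓜_b(Q; F)`, that is, against `C₀(Q)`. -/
def WeakStarTendsto (T : ℕ → 𝓓'(cube N, F)) (T' : 𝓓'(cube N, F)) : Prop :=
  ∃ (μ : ℕ → VectorMeasure (cube N) F) (μ' : VectorMeasure (cube N) F),
    (∀ n, IsRepresentedBy (T n) (μ n)) ∧ IsRepresentedBy T' μ' ∧
    ∀ φ : C₀(cube N, ℝ), Tendsto (fun n => ∫ᵛ x, φ x ∂•(μ n)) atTop (𝓝 (∫ᵛ x, φ x ∂•μ'))

end Distr

/-! ### First order operators and the spaces `BV` and `BV_𝓑` -/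

/-- The distributional gradient `D` of scalar distributions on `Q`. -/
noncomputable def grad (N : ℕ) : 𝓓'(cube N, ℝ) →L[ℝ] 𝓓'(cube N, Tens N 1) :=
  ∑ i : Fin N, (Distribution.mapCLM (ContinuousLinearMap.toSpanSingleton ℝ (basisTens i))).comp
    (LineDeriv.lineDerivOpCLM ℝ 𝓓'(cube N, ℝ) (basisVec i))

/-- `u ∈ BV(Q)`. -/
def MemBV {N : ℕ} (u : L1Q N ℝ) : Prop :=
  IsBoundedMeasure (grad N (toDistr u))

/-- A first order operator `𝓑 = ∑ᵢ Bⁱ ∂ᵢ` from `𝕄^{N^l}`-valued to `𝕄^{N^{l+1}}`-valued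
distributions, given by its constant coefficients: `B i (J, K)` is the entry of `Bⁱ` with output
index `J` and input index `K`. Each `Bⁱ` carries the Euclidean norm. -/
abbrev FirstOrderOp (N l : ℕ) : Type :=
  Fin N → EuclideanSpace ℝ ((Fin (l + 1) → Fin N) × (Fin l → Fin N))

section Op

variable {N l : ℕ}

/-- `‖𝓑‖_{ℓ^∞} = ∑ᵢ ‖Bⁱ‖`. -/
noncomputable def coeffNorm (B : FirstOrderOp N l) : ℝ := ∑ i, ‖B i‖

/-- The linear map `(b τ)_J = ∑_K b_{J,K} τ_K` between spaces of tensors. -/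
noncomputable def contract
    (b : EuclideanSpace ℝ ((Fin (l + 1) → Fin N) × (Fin l → Fin N))) :
    Tens N l →L[ℝ] Tens N (l + 1) :=
  LinearMap.toContinuousLinearMap
    (Matrix.toLpLin 2 2 (Matrix.of fun J K => b (J, K)))

theorem contract_apply
    (b : EuclideanSpace ℝ ((Fin (l + 1) → Fin N) × (Fin l → Fin N))) (τ : Tens N l)
    (J : Fin (l + 1) → Fin N) : contract b τ J = ∑ K, b (J, K) * τ K := by
  simp [contract, Matrix.toLpLin_apply, Matrix.mulVec, dotProduct]

/-- The action `𝓑 T = ∑ᵢ Bⁱ ∂ᵢ T` on distributions. -/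
noncomputable def FirstOrderOp.toCLM (B : FirstOrderOp N l) :
    𝓓'(cube N, Tens N l) →L[ℝ] 𝓓'(cube N, Tens N (l + 1)) :=
  ∑ i : Fin N, (Distribution.mapCLM (contract (B i))).comp
    (LineDeriv.lineDerivOpCLM ℝ 𝓓'(cube N, Tens N l) (basisVec i))

/-- `𝓑 v` for `v ∈ L¹(Q; 𝕄^{N^l})`, in the sense of distributions. -/
noncomputable def applyL1 (B : FirstOrderOp N l) :
    L1Q N (Tens N l) →ₗ[ℝ] 𝓓'(cube N, Tens N (l + 1)) :=
  (B.toCLM : 𝓓'(cube N, Tens N l) →ₗ[ℝ] 𝓓'(cube N, Tens N (l + 1))).comp toDistr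

/-- `v ∈ BV_𝓑(Q; 𝕄^{N^l})`. -/
def MemBVOp (B : FirstOrderOp N l) (v : L1Q N (Tens N l)) : Prop :=
  IsBoundedMeasure (applyL1 B v)

/-- `‖v‖_{BV_𝓑} = ‖v‖_{L¹} + |𝓑 v|_{𝓜_b}`. -/
noncomputable def bvOpNorm (B : FirstOrderOp N l) (v : L1Q N (Tens N l)) : ℝ≥0∞ :=
  ‖v‖ₑ + measureNorm (applyL1 B v)

/-- `v` is (the restriction to `Q` of) a function in `C^∞(Q̄; 𝕄^{N^l})`. -/
def IsSmoothUpToBoundary (v : L1Q N (Tens N l)) : Prop :=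
  ∃ g : Pt N → Tens N l, ContDiff ℝ ∞ g ∧ (v : Pt N → Tens N l) =ᵐ[volQ N] g

/-- The basic assumption on an operator `𝓑`: the space `BV_𝓑` is a Banach space, functions smooth
up to the boundary are dense in it in the strict topology, and its injection into `L¹` is compact.
-/
structure IsBasic (B : FirstOrderOp N l) : Prop where
  complete : ∀ v : ℕ → L1Q N (Tens N l), (∀ n, MemBVOp B (v n)) →
    (∀ ε : ℝ≥0∞, 0 < ε → ∃ n₀, ∀ m ≥ n₀, ∀ n ≥ n₀, bvOpNorm B (v m - v n) < ε) →
    ∃ w, MemBVOp B w ∧ Tendsto (fun n => bvOpNorm B (v n - w)) atTop (𝓝 0)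
  dense : ∀ v, MemBVOp B v → ∃ w : ℕ → L1Q N (Tens N l),
    (∀ n, IsSmoothUpToBoundary (w n)) ∧ Tendsto w atTop (𝓝 v) ∧
    Tendsto (fun n => measureNorm (applyL1 B (w n))) atTop (𝓝 (measureNorm (applyL1 B v)))
  compact : IsCompact (closure {v | MemBVOp B v ∧ bvOpNorm B v ≤ 1})

/-- The class `Π_l`: operators with finite dimensional null-space that satisfy the basic
assumption. -/
def MemPi (B : FirstOrderOp N l) : Prop :=
  FiniteDimensional ℝ (LinearMap.ker (applyL1 B)) ∧ IsBasic B

/-- The compactness property of a collection `S` of operators: whenever `𝓑 n ∈ S` satisfy the basic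
assumption and `‖𝓑 n‖_{ℓ^∞} + ‖v n‖_{BV_{𝓑 n}}` is bounded, there are an operator `𝓑'` and
`v' ∈ BV_{𝓑'}` with, along a subsequence, `v n → v'` in `L¹` and `𝓑 n (v n) ⇀* 𝓑' v'` in `𝓜_b`. -/
def IsCompactCollection (S : Set (FirstOrderOp N l)) : Prop :=
  ∀ (B : ℕ → FirstOrderOp N l) (v : ℕ → L1Q N (Tens N l)),
    (∀ n, B n ∈ S) → (∀ n, IsBasic (B n)) → (∀ n, MemBVOp (B n) (v n)) →
    (∃ C : ℝ≥0, ∀ n, ENNReal.ofReal (coeffNorm (B n)) + bvOpNorm (B n) (v n) ≤ C) →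
    ∃ (B' : FirstOrderOp N l) (v' : L1Q N (Tens N l)) (s : ℕ → ℕ), StrictMono s ∧
      MemBVOp B' v' ∧ Tendsto (fun n => v (s n)) atTop (𝓝 v') ∧
      WeakStarTendsto (fun n => applyL1 (B (s n)) (v (s n))) (applyL1 B' v')

end Op

/-! ### The seminorm `PGV^{k+1}_{α, 𝓑[k]}` -/

/-- A `k`-tuple `𝓑[k] = (𝓑⁰, …, 𝓑^{k-1})`, where `𝓑^l` maps `𝕄^{N^{l+1}}`-valued to
`𝕄^{N^{l+2}}`-valued distributions. -/
abbrev OpTuple (N k : ℕ) : Type := ∀ l : Fin k, FirstOrderOp N (l + 1)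

/-- A `k`-tuple `(v_0, …, v_{k-1})` with `v_l ∈ L¹(Q; 𝕄^{N^{l+1}})`. -/
abbrev FieldTuple (N k : ℕ) : Type := ∀ l : Fin k, L1Q N (Tens N (l + 1))

variable {N k : ℕ}

/-- `v_l` for `l < k`, and `v_k = 0`. -/
noncomputable def FieldTuple.extZero (v : FieldTuple N k) (l : ℕ) : L1Q N (Tens N (l + 1)) :=
  if h : l < k then v ⟨l, h⟩ else 0

/-- `α_0 |Du - v_0| + ∑_{1 ≤ l < k} α_l |v_l - 𝓑^{l-1} v_{l-1}| + α_k |𝓑^{k-1} v_{k-1}|`, all norms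
being those of `𝓜_b(Q)`; the last term is the summand `l = k - 1` below because `v_k = 0`. -/
noncomputable def energy (α : Fin (k + 1) → ℝ) (B : OpTuple N k) (u : L1Q N ℝ)
    (v : FieldTuple N k) : ℝ≥0∞ :=
  ENNReal.ofReal (α 0) * measureNorm (grad N (toDistr u) - toDistr (FieldTuple.extZero v 0)) +
  ∑ l : Fin k, ENNReal.ofReal (α l.succ) *
    measureNorm (toDistr (FieldTuple.extZero v (l + 1)) - applyL1 (B l) (v l))

/-- `PGV^{k+1}_{α, 𝓑[k]}(u)`: the infimum of the energy over `v_l ∈ BV_{𝓑^l}(Q; 𝕄^{N^{l+1}})`. -/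
noncomputable def pgv (α : Fin (k + 1) → ℝ) (B : OpTuple N k) (u : L1Q N ℝ) : ℝ≥0∞ :=
  ⨅ (v : FieldTuple N k) (_ : ∀ l, MemBVOp (B l) (v l)), energy α B u v

end PGV

namespace PGV

/-! The argument has the shape of a Γ-convergence proof: a compactness and semicontinuity half for
the lower bound, a recovery half for the upper bound.

Lower bound. Take almost optimal tuples `v n` for the operators `Bn n` along a subsequence. The
weights stay away from zero, so every defect `Du - v_0`, `v_{l+1} - 𝓑^l v_l` (with `v_k = 0`) is
bounded in total variation. The tuples are then bounded in `L¹` (`exists_norm_le_of_defectsLE`):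
otherwise, after normalization, the defects and the multiple of `Du` tend to zero, and compactness
yields a limit tuple of norm one with `v_0 = 0` and `v_{l+1} = 𝓑^l v_l`, hence zero, a
contradiction. Boundedness gives an `L¹` limit of the original tuples. It is a competitor for the
limit problem, and `exists_energy_le` concludes by semicontinuity of the total variation.

Upper bound. A competitor `v` for `B` need not lie in the spaces attached to `Bn n`, so it is first
smoothed. Averages `∫ η(y - s x) f(y) dy`, with `s < 1` and `η` supported within `(1 - s) / 2` of
the origin, use only values of `f` inside the cube. First order operators commute with this
averaging up to the factor `s`, so the energy increases only slightly (`exists_conv_energy_lt`). A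
smoothed tuple is admissible for every operator, with an image depending continuously on the
coefficients; with the smoothing fixed, `n → ∞` gives `eventually_pgv_lt`.

Both halves rest on a dual description of total variation: `measureNorm T` is the supremum of `∑ ‖T
ψ_i‖` over finite families with `∑ |ψ_i| ≤ 1`. -/

instance locallyCompactSpace_cube (N : ℕ) : LocallyCompactSpace (cube N) :=
  (cube N).isOpen.locallyCompactSpace

/-! ### Total variation by duality with finite families of test functions -/

section MeasureNorm

theorem integrable_comp_subtypeVal {N : ℕ} {F : Type*} [NormedAddCommGroup F] (v : L1Q N F) :
    Integrable (fun x : cube N => v x) (Measure.comap Subtype.val volume) :=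
  (integrableOn_iff_comap_subtypeVal (cube N).isOpen.measurableSet).1 (L1.integrable_coeFn v)

variable {N : ℕ} {F : Type*} [NormedAddCommGroup F] [NormedSpace ℝ F]

theorem integrable_testFunction (ψ : 𝓓(cube N, ℝ)) (ν : Measure (cube N)) [IsFiniteMeasure ν] :
    Integrable (fun x : cube N => ψ x) ν := by
  obtain ⟨C, hC⟩ := ψ.hasCompactSupport.exists_bound_of_continuous ψ.contDiff.continuous
  refine Integrable.of_bound (C := C) ?_ (.of_forall fun x => hC x)
  exact (ψ.contDiff.continuous.comp continuous_subtype_val).aestronglyMeasurable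

theorem IsRepresentedBy.add {T S : 𝓓'(cube N, F)} {μ ν : VectorMeasure (cube N) F}
    (hT : IsRepresentedBy T μ) (hS : IsRepresentedBy S ν) : IsRepresentedBy (T + S) (μ + ν) := by
  have := hT.1
  have := hS.1
  refine ⟨isFiniteMeasure_of_le _ VectorMeasure.variation_add_le, fun ψ => ?_⟩
  rw [VectorMeasure.integral_add_vectorMeasure (integrable_testFunction ψ _)
    (integrable_testFunction ψ _), ← hT.2, ← hS.2]
  rfl

theorem IsRepresentedBy.smul {T : 𝓓'(cube N, F)} {μ : VectorMeasure (cube N) F}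
    (hT : IsRepresentedBy T μ) (c : ℝ) : IsRepresentedBy (c • T) (c • μ) := by
  have := hT.1
  refine ⟨inferInstance, fun ψ => ?_⟩
  rw [VectorMeasure.integral_smul_vectorMeasure, ← hT.2]
  rfl

theorem IsBoundedMeasure.add {T S : 𝓓'(cube N, F)} (hT : IsBoundedMeasure T)
    (hS : IsBoundedMeasure S) : IsBoundedMeasure (T + S) :=
  let ⟨_, h⟩ := hT
  let ⟨_, h'⟩ := hS
  ⟨_, h.add h'⟩

theorem IsBoundedMeasure.smul {T : 𝓓'(cube N, F)} (hT : IsBoundedMeasure T) (c : ℝ) :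
    IsBoundedMeasure (c • T) :=
  let ⟨_, h⟩ := hT
  ⟨_, h.smul c⟩

theorem IsBoundedMeasure.sub {T S : 𝓓'(cube N, F)} (hT : IsBoundedMeasure T)
    (hS : IsBoundedMeasure S) : IsBoundedMeasure (T - S) := by
  have := hT.add (hS.smul (-1))
  rwa [neg_one_smul, ← sub_eq_add_neg] at this

theorem measureNorm_le {T : 𝓓'(cube N, F)} {μ : VectorMeasure (cube N) F}
    (h : IsRepresentedBy T μ) : measureNorm T ≤ μ.variation Set.univ :=
  iInf₂_le _ h

theorem isBoundedMeasure_of_measureNorm_ne_top {T : 𝓓'(cube N, F)} (h : measureNorm T ≠ ⊤) :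
    IsBoundedMeasure T := by
  by_contra hT
  exact h (iInf₂_eq_top.2 fun μ hμ => (hT ⟨μ, hμ⟩).elim)

theorem IsBoundedMeasure.measureNorm_ne_top {T : 𝓓'(cube N, F)} (h : IsBoundedMeasure T) :
    measureNorm T ≠ ⊤ := by
  obtain ⟨μ, hμ⟩ := h
  have := hμ.1
  exact ((measureNorm_le hμ).trans_lt (measure_lt_top _ _)).ne

theorem measureNorm_add_le (T S : 𝓓'(cube N, F)) :
    measureNorm (T + S) ≤ measureNorm T + measureNorm S := by
  rw [measureNorm, measureNorm, measureNorm, ENNReal.iInf_add]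
  refine le_iInf fun μ => ?_
  rw [ENNReal.iInf_add]
  refine le_iInf fun hμ => ?_
  rw [ENNReal.add_iInf]
  refine le_iInf fun ν => ?_
  rw [ENNReal.add_iInf]
  refine le_iInf fun hν => ?_
  refine (iInf₂_le _ (hμ.add hν)).trans ?_
  exact VectorMeasure.variation_add_le Set.univ


/-- Each `‖T ψ_i‖` is at most `∫ |ψ_i| d|μ|`, and the sum can be taken under the integral. Families
are needed because `T` is vector valued while test functions are scalar: one `ψ` cannot follow the
changing direction of `μ`. -/
theorem sum_enorm_apply_le {T : 𝓓'(cube N, F)} {ι : Type*} (s : Finset ι)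
    (ψ : ι → 𝓓(cube N, ℝ)) {c : ℝ≥0∞} (hψ : ∀ x, ∑ i ∈ s, ‖ψ i x‖ₑ ≤ c) (hc : c ≠ ⊤) :
    ∑ i ∈ s, ‖T (ψ i)‖ₑ ≤ c * measureNorm T := by
  by_cases hT : IsBoundedMeasure T
  swap
  · have : measureNorm T = ⊤ := by
      by_contra h
      exact hT (isBoundedMeasure_of_measureNorm_ne_top h)
    -- Since `0 * ⊤ = 0` in `ℝ≥0∞`, the case `c = 0` is not covered by the infinite norm; there all
    -- the `ψ i` vanish.
    rcases eq_or_ne c 0 with rfl | h0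
    · have h1 : ∀ i ∈ s, ψ i = 0 := fun i hi => by
        ext x
        have := (Finset.single_le_sum (f := fun i => ‖ψ i x‖ₑ) (fun _ _ => zero_le) hi).trans (hψ x)
        simpa using this
      rw [Finset.sum_eq_zero fun i hi => by rw [h1 i hi, map_zero, enorm_zero]]
      exact zero_le
    · rw [this, ENNReal.mul_top h0]
      exact le_top
  have key : ∀ μ, IsRepresentedBy T μ → ∑ i ∈ s, ‖T (ψ i)‖ₑ ≤ c * μ.variation Set.univ := by
    intro μ hμ
    have := hμ.1
    calc ∑ i ∈ s, ‖T (ψ i)‖ₑ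
        ≤ ∑ i ∈ s, ∫⁻ x : cube N, ‖ψ i x‖ₑ ∂μ.variation := by
          refine Finset.sum_le_sum fun i _ => ?_
          rw [hμ.2]
          refine VectorMeasure.enorm_integral_le_lintegral_enorm_transpose.trans ?_
          rw [VectorMeasure.variation_transpose_lsmul]
      _ = ∫⁻ x : cube N, ∑ i ∈ s, ‖ψ i x‖ₑ ∂μ.variation := by
          rw [lintegral_finsetSum']
          exact fun i _ => ((ψ i).contDiff.continuous.comp
            continuous_subtype_val).measurable.enorm.aemeasurable
      _ ≤ ∫⁻ _ : cube N, c ∂μ.variation := lintegral_mono fun x => hψ x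
      _ = c * μ.variation Set.univ := by simp
  rcases eq_or_ne c 0 with rfl | h0
  · obtain ⟨μ, hμ⟩ := hT
    simpa using key μ hμ
  rw [measureNorm, ENNReal.mul_iInf_of_ne h0 hc]
  refine le_iInf fun μ => ?_
  rw [ENNReal.mul_iInf_of_ne h0 hc]
  exact le_iInf fun hμ => key μ hμ

theorem enorm_apply_le (T : 𝓓'(cube N, F)) (ψ : 𝓓(cube N, ℝ)) {c : ℝ≥0} (hψ : ∀ x, ‖ψ x‖ₑ ≤ c) :
    ‖T ψ‖ₑ ≤ c * measureNorm T := by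
  simpa using sum_enorm_apply_le (T := T) {()} (fun _ => ψ) (by simpa using hψ) ENNReal.coe_ne_top

theorem exists_testFunction_one_on {K U : Set (cube N)} (hK : IsCompact K) (hU : IsOpen U)
    (hKU : K ⊆ U) : ∃ ψ : 𝓓(cube N, ℝ), (∀ x, ψ x ∈ Set.Icc (0 : ℝ) 1) ∧ (∀ x ∈ K, ψ x = 1) ∧
      ∀ x : cube N, x ∉ U → ψ x = 0 := by
  have hU' : IsOpen (Subtype.val '' U : Set (Pt N)) := (cube N).isOpen.isOpenMap_subtype_val _ hU
  have hK' : IsCompact (Subtype.val '' K : Set (Pt N)) := hK.image continuous_subtype_val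
  obtain ⟨L, hL, hKL, hLU⟩ := exists_compact_between hK' hU' (Set.image_mono hKU)
  obtain ⟨f, hf, hr, hs, h1⟩ := exists_contMDiff_support_eq_eq_one_iff (modelWithCornersSelf ℝ (Pt N))
    isOpen_interior hK'.isClosed hKL
  have hts : tsupport f ⊆ L := by
    rw [tsupport, hs]
    exact closure_minimal interior_subset hL.isClosed
  refine ⟨⟨f, hf.contDiff, hL.of_isClosed_subset (isClosed_tsupport f) hts,
    hts.trans (hLU.trans (by rintro _ ⟨x, -, rfl⟩; exact x.2))⟩, fun x => hr ⟨x, rfl⟩,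
    fun x hx => (h1 x).1 ⟨x, hx, rfl⟩, fun x hx => ?_⟩
  by_contra h
  have : (x : Pt N) ∈ Function.support f := h
  rw [hs] at this
  obtain ⟨y, hy, hyx⟩ := hLU (interior_subset this)
  exact hx (Subtype.ext hyx ▸ hy)

theorem exists_pairwise_disjoint_open {X ι : Type*} [PseudoEMetricSpace X] [T2Space X]
    (P : Finset ι) (K : ι → Set X) (hK : ∀ i ∈ P, IsCompact (K i))
    (hd : (P : Set ι).PairwiseDisjoint K) :
    ∃ U : ι → Set X, (∀ i, IsOpen (U i)) ∧ (∀ i, K i ⊆ U i) ∧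
      (P : Set ι).PairwiseDisjoint U := by
  classical
  have h : ∀ p ∈ P.offDiag, ∀ᶠ δ in 𝓝[>] (0 : ℝ),
      Disjoint (Metric.thickening δ (K p.1)) (Metric.thickening δ (K p.2)) := by
    intro p hp
    rw [Finset.mem_offDiag] at hp
    obtain ⟨δ, hδ, hdis⟩ := (hd hp.1 hp.2.1 hp.2.2).exists_thickenings (hK _ hp.1)
      (hK _ hp.2.1).isClosed
    filter_upwards [Ioo_mem_nhdsGT hδ] with ε hε
    exact hdis.mono (Metric.thickening_mono hε.2.le _) (Metric.thickening_mono hε.2.le _)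
  obtain ⟨δ, hδ, hpos⟩ :=
    (((Finset.eventually_all _).2 h).and self_mem_nhdsWithin).exists
  exact ⟨fun i => Metric.thickening δ (K i), fun i => Metric.isOpen_thickening,
    fun i => Metric.self_subset_thickening hpos _,
    fun i hi j hj hij => hδ (i, j) (Finset.mem_offDiag.2 ⟨hi, hj, hij⟩)⟩

/-- The converse half of the duality. Disjoint sets almost realizing the variation are shrunk to
compact sets by inner regularity; these have disjoint open neighbourhoods, and each carries a cutoff
equal to one on the compact set. Disjointness of the neighbourhoods gives `∑ |ψ_i| ≤ 1`. -/
theorem IsRepresentedBy.exists_lt_sum [CompleteSpace F] {T : 𝓓'(cube N, F)}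
    {μ : VectorMeasure (cube N) F}
    (h : IsRepresentedBy T μ) {a : ℝ≥0∞} (ha : a < μ.variation Set.univ) :
    ∃ (P : Finset (Set (cube N))) (ψ : Set (cube N) → 𝓓(cube N, ℝ)),
      (∀ x, ∑ i ∈ P, ‖ψ i x‖ₑ ≤ 1) ∧ a < ∑ i ∈ P, ‖T (ψ i)‖ₑ := by
  have := h.1
  obtain ⟨P, -, hdis, hmeas, hsum⟩ := μ.exists_lt_sum_of_lt_variation MeasurableSet.univ ha
  -- Each set of `P` costs `ε` twice: once for passing from `p` to its compact part, once for the
  -- cutoff outside that part.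
  obtain ⟨ε, hε, hεlt⟩ : ∃ ε : ℝ≥0∞, ε ≠ 0 ∧ a + P.card * (ε + ε) < ∑ p ∈ P, ‖μ p‖ₑ := by
    have h1 : Tendsto (fun ε : ℝ≥0∞ => a + P.card * (ε + ε)) (𝓝 0) (𝓝 (a + P.card * (0 + 0))) :=
      tendsto_const_nhds.add (ENNReal.Tendsto.const_mul (tendsto_id.add tendsto_id)
        (Or.inr (ENNReal.natCast_ne_top _)))
    have h2 : ∀ᶠ ε in 𝓝[>] (0 : ℝ≥0∞), a + P.card * (ε + ε) < ∑ p ∈ P, ‖μ p‖ₑ :=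
      (h1.mono_left nhdsWithin_le_nhds).eventually_lt_const (by simpa using hsum)
    obtain ⟨ε, hε, hpos⟩ := (h2.and self_mem_nhdsWithin).exists
    exact ⟨ε, hpos.ne', hε⟩
  have hK : ∀ p : Set (cube N), ∃ K, p ∈ P → K ⊆ p ∧ IsCompact K ∧ μ.variation (p \ K) < ε := by
    intro p
    by_cases hp : p ∈ P
    · obtain ⟨K, h1, h2, h3⟩ := (hmeas p hp).exists_isCompact_sdiff_lt
        (measure_ne_top μ.variation p) hε
      exact ⟨K, fun _ => ⟨h1, h2, h3⟩⟩
    · exact ⟨∅, fun h => (hp h).elim⟩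
  choose K hK using hK
  obtain ⟨V, hVo, hKV, hVd⟩ := exists_pairwise_disjoint_open P K (fun p hp => (hK p hp).2.1)
    (fun p hp q hq hpq => (hdis hp hq hpq).mono (hK p hp).1 (hK q hq).1)
  have hψ : ∀ p : Set (cube N), ∃ ψ : 𝓓(cube N, ℝ), p ∈ P → (∀ x, ψ x ∈ Set.Icc (0 : ℝ) 1) ∧
      (∀ x : cube N, x ∉ V p → ψ x = 0) ∧ ‖μ p‖ₑ ≤ ‖T ψ‖ₑ + (ε + ε) := by
    intro p
    by_cases hp : p ∈ P
    swap
    · exact ⟨0, fun h => (hp h).elim⟩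
    obtain ⟨hKp, hKc, hKε⟩ := hK p hp
    obtain ⟨U, hKU, hUo, hUε⟩ := hKc.exists_isOpen_lt_add (μ := μ.variation) hε
    obtain ⟨ψ, h01, hψ1, hψ0⟩ := exists_testFunction_one_on hKc (hUo.inter (hVo p))
      (Set.subset_inter hKU (hKV p))
    refine ⟨ψ, fun _ => ⟨h01, fun x hx => hψ0 x fun h => hx h.2, ?_⟩⟩
    have e1 : ‖μ (p \ K p)‖ₑ ≤ ε := (μ.enorm_measure_le_variation _).trans hKε.le
    have hKm : MeasurableSet (K p) := hKc.measurableSet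
    have e2 : ‖T ψ - μ (K p)‖ₑ ≤ ε := by
      have : μ (K p) = ∫ᵛ x, (K p).indicator (fun _ => (1 : ℝ)) x ∂•μ := by
        rw [VectorMeasure.integral_indicator_const _ hKm]
        simp
      rw [this, h.2, ← VectorMeasure.integral_fun_sub (integrable_testFunction ψ _)
        ((integrable_const (1 : ℝ)).indicator hKm)]
      refine VectorMeasure.enorm_integral_le_lintegral_enorm_transpose.trans ?_
      rw [VectorMeasure.variation_transpose_lsmul]
      calc _ ≤ ∫⁻ x, (U \ K p).indicator (fun _ => (1 : ℝ≥0∞)) x ∂μ.variation := by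
            refine lintegral_mono fun x => ?_
            by_cases hxK : x ∈ K p
            · simp [hxK, hψ1 x hxK]
            by_cases hxU : x ∈ U
            · have := h01 x
              simp only [hxK, hxU, not_false_eq_true, Set.indicator_of_notMem, sub_zero,
                Set.indicator_of_mem, Set.mem_sdiff, and_self]
              rw [Real.enorm_eq_ofReal this.1]
              exact ENNReal.ofReal_le_one.2 this.2
            · simp [hxK, hxU, hψ0 x (fun h => hxU h.1)]
        _ = μ.variation (U \ K p) := by
            rw [lintegral_indicator (hUo.measurableSet.diff hKm)]
            simp
        _ ≤ ε := by
            rw [measure_sdiff hKU hKm.nullMeasurableSet (measure_ne_top _ _)]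
            exact tsub_le_iff_left.2 hUε.le
    have e3 : μ p = T ψ + (μ (p \ K p) - (T ψ - μ (K p))) := by
      have : μ p = μ (K p) + μ (p \ K p) := by
        rw [VectorMeasure.of_add_of_sdiff hKm (hmeas p hp) hKp]
      rw [this]; abel
    rw [e3]
    refine (enorm_add_le _ _).trans ?_
    gcongr
    exact (enorm_sub_le).trans (add_le_add e1 e2)
  choose ψ hψ using hψ
  refine ⟨P, ψ, fun x => ?_, ?_⟩
  · by_cases hx : ∃ h : x ∈ cube N, ∃ p ∈ P, (⟨x, h⟩ : cube N) ∈ V p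
    · obtain ⟨h, p, hp, hxp⟩ := hx
      rw [Finset.sum_eq_single_of_mem p hp fun q hq hqp => ?_]
      · have := (hψ p hp).1 x
        rw [Real.enorm_eq_ofReal this.1]
        exact ENNReal.ofReal_le_one.2 this.2
      · rw [(hψ q hq).2.1 ⟨x, h⟩ fun hxq => Set.disjoint_left.1 (hVd hq hp hqp) hxq hxp, enorm_zero]
    · rw [Finset.sum_eq_zero fun q hq => ?_]
      · exact zero_le
      · by_cases h : x ∈ cube N
        · rw [(hψ q hq).2.1 ⟨x, h⟩ fun hxq => hx ⟨h, q, hq, hxq⟩, enorm_zero]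
        · rw [image_eq_zero_of_notMem_tsupport fun h' => h ((ψ q).tsupport_subset h'), enorm_zero]
  · have : ∑ p ∈ P, ‖μ p‖ₑ ≤ ∑ p ∈ P, ‖T (ψ p)‖ₑ + P.card * (ε + ε) := by
      rw [← nsmul_eq_mul, ← Finset.sum_const, ← Finset.sum_add_distrib]
      exact Finset.sum_le_sum fun p hp => (hψ p hp).2.2
    have h2 := hεlt.trans_le this
    exact lt_of_add_lt_add_right h2

variable [CompleteSpace F]

theorem IsRepresentedBy.variation_le {T : 𝓓'(cube N, F)} {μ : VectorMeasure (cube N) F}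
    (h : IsRepresentedBy T μ) {C : ℝ≥0∞}
    (hC : ∀ (P : Finset (Set (cube N))) (ψ : Set (cube N) → 𝓓(cube N, ℝ)),
      (∀ x, ∑ i ∈ P, ‖ψ i x‖ₑ ≤ 1) → ∑ i ∈ P, ‖T (ψ i)‖ₑ ≤ C) :
    μ.variation Set.univ ≤ C := by
  by_contra! hlt
  obtain ⟨P, ψ, hψ, hs⟩ := h.exists_lt_sum hlt
  exact (hC P ψ hψ).not_gt hs

theorem IsRepresentedBy.measureNorm_eq {T : 𝓓'(cube N, F)} {μ : VectorMeasure (cube N) F}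
    (h : IsRepresentedBy T μ) : measureNorm T = μ.variation Set.univ :=
  (measureNorm_le h).antisymm <| h.variation_le fun P ψ hψ => by
    simpa using sum_enorm_apply_le (T := T) P ψ hψ ENNReal.one_ne_top

theorem IsBoundedMeasure.measureNorm_le_of_forall {T : 𝓓'(cube N, F)} (h : IsBoundedMeasure T)
    {C : ℝ≥0∞} (hC : ∀ (P : Finset (Set (cube N))) (ψ : Set (cube N) → 𝓓(cube N, ℝ)),
      (∀ x, ∑ i ∈ P, ‖ψ i x‖ₑ ≤ 1) → ∑ i ∈ P, ‖T (ψ i)‖ₑ ≤ C) :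
    measureNorm T ≤ C :=
  let ⟨_, hμ⟩ := h
  (measureNorm_le hμ).trans (hμ.variation_le hC)

theorem IsBoundedMeasure.measureNorm_smul {T : 𝓓'(cube N, F)} (h : IsBoundedMeasure T) (c : ℝ) :
    measureNorm (c • T) = ‖c‖ₑ * measureNorm T := by
  obtain ⟨μ, hμ⟩ := h
  rw [hμ.measureNorm_eq, (hμ.smul c).measureNorm_eq, VectorMeasure.variation_smul]
  rfl

theorem IsBoundedMeasure.measureNorm_sub_le {T S : 𝓓'(cube N, F)} (hS : IsBoundedMeasure S) :
    measureNorm (T - S) ≤ measureNorm T + measureNorm S := by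
  have := measureNorm_add_le T ((-1 : ℝ) • S)
  rw [hS.measureNorm_smul] at this
  simpa [← sub_eq_add_neg] using this

/-- For a fixed family the sums converge, and a supremum of such quantities is lower semicontinuous.
Only convergence on each test function enters; that the limit is a bounded measure is a hypothesis.
-/
theorem IsBoundedMeasure.measureNorm_le_liminf {ι : Type*} {l : Filter ι} [l.NeBot]
    {T : ι → 𝓓'(cube N, F)}
    {S : 𝓓'(cube N, F)} (hS : IsBoundedMeasure S)
    (h : ∀ ψ, Tendsto (fun n => T n ψ) l (𝓝 (S ψ))) :
    measureNorm S ≤ liminf (fun n => measureNorm (T n)) l := by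
  refine hS.measureNorm_le_of_forall fun P ψ hψ => ?_
  have h1 : Tendsto (fun n => ∑ i ∈ P, ‖T n (ψ i)‖ₑ) l (𝓝 (∑ i ∈ P, ‖S (ψ i)‖ₑ)) :=
    tendsto_finsetSum _ fun i _ => (h (ψ i)).enorm
  rw [← h1.liminf_eq]
  refine liminf_le_liminf (.of_forall fun n => ?_)
  simpa using sum_enorm_apply_le (T := T n) P ψ hψ ENNReal.one_ne_top

/-- True on indicators by definition of the density, then on simple functions by linearity. Bounded
simple approximations of `ψ` pass to the limit by dominated convergence on both sides. -/
theorem integral_withDensityᵥ {X : Type*} [MeasurableSpace X] {ν : Measure X} {f : X → F}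
    (hf : Integrable f ν) {ψ : X → ℝ} (hψ : Measurable ψ) {C : ℝ} (hC : ∀ x, ‖ψ x‖ ≤ C) :
    ∫ᵛ x, ψ x ∂•(ν.withDensityᵥ f) = ∫ x, ψ x • f x ∂ν := by
  have hvar := Measure.variation_withDensityᵥ hf
  have hfin : IsFiniteMeasure (ν.withDensityᵥ f).variation := by
    rw [hvar]
    exact ⟨by simpa using! hf.2⟩
  have hint : ∀ {g : X → ℝ} {C : ℝ}, Measurable g → (∀ x, ‖g x‖ ≤ C) →
      (ν.withDensityᵥ f).Integrable g := fun hg hC =>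
    Integrable.of_bound hg.aestronglyMeasurable _ (.of_forall hC)
  have hsimple : ∀ g : SimpleFunc X ℝ, ∫ᵛ x, g x ∂•(ν.withDensityᵥ f) = ∫ x, g x • f x ∂ν := by
    intro g
    induction g using SimpleFunc.induction with
    | const c hs =>
      rename_i s
      simp only [SimpleFunc.const_zero, SimpleFunc.coe_piecewise, SimpleFunc.coe_const,
        SimpleFunc.coe_zero, Set.piecewise_eq_indicator]
      rw [show (fun x => s.indicator (Function.const X c) x) = s.indicator fun _ => c from rfl,
        VectorMeasure.integral_indicator_const _ hs, withDensityᵥ_apply hf hs]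
      have : (fun x => s.indicator (Function.const X c) x • f x) =
          s.indicator (fun x => c • f x) := by
        ext x
        by_cases hx : x ∈ s <;> simp [hx]
      rw [this, integral_indicator hs, integral_smul]
      rfl
    | add hd hg hh =>
      rename_i g h
      obtain ⟨C, hC⟩ := g.exists_forall_norm_le
      obtain ⟨D, hD⟩ := h.exists_forall_norm_le
      simp only [SimpleFunc.coe_add, Pi.add_apply]
      rw [VectorMeasure.integral_fun_add (hint g.measurable hC) (hint h.measurable hD), hg, hh]
      simp only [add_smul]
      exact (integral_add (hf.bdd_smul _ g.measurable.aestronglyMeasurable (.of_forall hC))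
          (hf.bdd_smul _ h.measurable.aestronglyMeasurable (.of_forall hD))).symm
  rcases isEmpty_or_nonempty X with hX | ⟨⟨x₀⟩⟩
  · simp [VectorMeasure.integral_of_isEmpty, Measure.eq_zero_of_isEmpty ν]
  have hC0 : 0 ≤ C := (norm_nonneg _).trans (hC x₀)
  have hψs := hψ.stronglyMeasurable
  have hlim : ∀ x, Tendsto (fun n => hψs.approxBounded C n x) atTop (𝓝 (ψ x)) := fun x =>
    hψs.tendsto_approxBounded_of_norm_le (hC x)
  have hle := hψs.norm_approxBounded_le hC0
  have h1 : Tendsto (fun n => ∫⁻ x, ‖hψs.approxBounded C n x - ψ x‖ₑ ∂(ν.withDensityᵥ f).variation)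
      atTop (𝓝 (∫⁻ _, 0 ∂(ν.withDensityᵥ f).variation)) := by
    refine tendsto_lintegral_of_dominated_convergence (fun _ => ENNReal.ofReal (C + C))
      (fun n => ((hψs.approxBounded C n).measurable.sub hψ).enorm) (fun n => .of_forall fun x => ?_)
      (by simp [ENNReal.mul_eq_top]) (.of_forall fun x => ?_)
    · change ‖_‖ₑ ≤ _
      rw [← ofReal_norm]
      exact ENNReal.ofReal_le_ofReal ((norm_sub_le _ _).trans (add_le_add (hle n x) (hC x)))
    · simpa using ((hlim x).sub_const (ψ x)).enorm
  rw [lintegral_zero] at h1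
  have h2 := VectorMeasure.tendsto_integral_of_L1 (B := ContinuousLinearMap.lsmul ℝ ℝ)
    (μ := ν.withDensityᵥ f) ψ
    hψ.aestronglyMeasurable (.of_forall fun n => hint (hψs.approxBounded C n).measurable (hle n)) h1
  simp only [hsimple] at h2
  refine tendsto_nhds_unique h2 (tendsto_integral_of_dominated_convergence (fun x => C * ‖f x‖)
    (fun n => ?_) (hf.norm.const_mul C) (fun n => .of_forall fun x => ?_) (.of_forall fun x => ?_))
  · exact (hψs.approxBounded C n).measurable.aestronglyMeasurable.smul hf.1
  · rw [norm_smul]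
    gcongr
    exact hle n x
  · exact (hlim x).smul_const _

theorem variation_withDensityᵥ_univ (v : L1Q N F) :
    ((Measure.comap Subtype.val volume : Measure (cube N)).withDensityᵥ
      fun x => v x).variation Set.univ = ‖v‖ₑ := by
  rw [Measure.variation_withDensityᵥ (integrable_comp_subtypeVal v), withDensity_apply _ .univ,
    Measure.restrict_univ, Lp.enorm_def, eLpNorm_one_eq_lintegral_enorm]
  exact lintegral_subtype_comap (cube N).isOpen.measurableSet fun x => ‖v x‖ₑ

theorem isRepresentedBy_toDistr (v : L1Q N F) :
    IsRepresentedBy (toDistr v) ((Measure.comap Subtype.val volume : Measure (cube N)).withDensityᵥ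
      fun x => v x) := by
  refine ⟨⟨?_⟩, fun ψ => ?_⟩
  · rw [variation_withDensityᵥ_univ]
    exact enorm_lt_top
  · obtain ⟨C, hC⟩ := ψ.hasCompactSupport.exists_bound_of_continuous ψ.contDiff.continuous
    rw [toDistr_apply]
    refine .trans ?_ (integral_withDensityᵥ (integrable_comp_subtypeVal v)
      (ψ.contDiff.continuous.comp continuous_subtype_val).measurable fun x => hC x).symm
    exact (integral_subtype_comap (cube N).isOpen.measurableSet fun x => ψ x • v x).symm

theorem isBoundedMeasure_toDistr (v : L1Q N F) : IsBoundedMeasure (toDistr v) :=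
  ⟨_, isRepresentedBy_toDistr v⟩

theorem measureNorm_toDistr (v : L1Q N F) : measureNorm (toDistr v) = ‖v‖ₑ := by
  rw [(isRepresentedBy_toDistr v).measureNorm_eq, variation_withDensityᵥ_univ]

end MeasureNorm
end PGV

namespace PGV

/-! ### Coefficient tensors and the action of first order operators -/

section Contract

variable {N l : ℕ}

theorem norm_contract_apply_le
    (b : EuclideanSpace ℝ ((Fin (l + 1) → Fin N) × (Fin l → Fin N))) (τ : Tens N l) :
    ‖contract b τ‖ ≤ ‖b‖ * ‖τ‖ := by
  refine abs_le_of_sq_le_sq' ?_ (by positivity) |>.2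
  rw [mul_pow, EuclideanSpace.norm_sq_eq, EuclideanSpace.norm_sq_eq, EuclideanSpace.norm_sq_eq,
    Fintype.sum_prod_type, Finset.sum_mul]
  refine Finset.sum_le_sum fun J _ => ?_
  simp only [contract_apply, Real.norm_eq_abs, sq_abs]
  exact Finset.sum_mul_sq_le_sq_mul_sq _ _ _

theorem contract_add (b c : EuclideanSpace ℝ ((Fin (l + 1) → Fin N) × (Fin l → Fin N))) :
    contract (b + c) = contract b + contract c := by
  ext τ J
  simp [contract_apply, add_mul, Finset.sum_add_distrib]

theorem contract_sub (b c : EuclideanSpace ℝ ((Fin (l + 1) → Fin N) × (Fin l → Fin N))) :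
    contract (b - c) = contract b - contract c := by
  rw [eq_sub_iff_add_eq, ← contract_add, sub_add_cancel]

theorem tendsto_contract {ι : Type*} {f : Filter ι}
    {b : ι → EuclideanSpace ℝ ((Fin (l + 1) → Fin N) × (Fin l → Fin N))} {b₀}
    {τ : ι → Tens N l} {τ₀} (hb : Tendsto b f (𝓝 b₀)) (hτ : Tendsto τ f (𝓝 τ₀)) :
    Tendsto (fun n => contract (b n) (τ n)) f (𝓝 (contract b₀ τ₀)) := by
  have h1 : Tendsto (fun n => contract (b n - b₀) (τ n)) f (𝓝 0) := by
    refine squeeze_zero_norm (fun n => norm_contract_apply_le _ _) ?_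
    simpa using (hb.sub_const b₀).norm.mul hτ.norm
  have h2 := h1.add (((contract b₀).continuous.tendsto _).comp hτ)
  simpa [contract_sub] using h2

end Contract

section Apply

variable {N l : ℕ}

theorem toCLM_apply (B : FirstOrderOp N l) (T : 𝓓'(cube N, Tens N l)) (ψ : 𝓓(cube N, ℝ)) :
    B.toCLM T ψ = -∑ i, contract (B i) (T (∂_{basisVec i} ψ)) := by
  rw [← Finset.sum_neg_distrib, FirstOrderOp.toCLM]
  simp only [sum_apply, ContinuousLinearMap.comp_apply]
  refine Finset.sum_congr rfl fun i _ => ?_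
  rw [Distribution.mapCLM_apply, ← map_neg]
  rfl

theorem applyL1_apply (B : FirstOrderOp N l) (v : L1Q N (Tens N l)) (ψ : 𝓓(cube N, ℝ)) :
    applyL1 B v ψ = -∑ i, contract (B i) (toDistr v (∂_{basisVec i} ψ)) :=
  toCLM_apply B (toDistr v) ψ

theorem applyL1_add (B C : FirstOrderOp N l) (v : L1Q N (Tens N l)) :
    applyL1 (B + C) v = applyL1 B v + applyL1 C v := by
  ext1 ψ
  change _ = applyL1 B v ψ + applyL1 C v ψ
  simp only [applyL1_apply, Pi.add_apply, contract_add, add_apply,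
    Finset.sum_add_distrib, neg_add]

theorem tendsto_of_coeffNorm {ι : Type*} {f : Filter ι} {B : ι → FirstOrderOp N l}
    {B₀ : FirstOrderOp N l} (h : Tendsto (fun n => coeffNorm (B n - B₀)) f (𝓝 0)) :
    Tendsto B f (𝓝 B₀) := by
  rw [tendsto_pi_nhds]
  intro i
  rw [tendsto_iff_norm_sub_tendsto_zero]
  exact squeeze_zero (fun _ => norm_nonneg _)
    (fun n => Finset.single_le_sum (f := fun i => ‖(B n - B₀) i‖) (fun _ _ => norm_nonneg _)
      (Finset.mem_univ i)) h

theorem continuous_coeffNorm : Continuous (coeffNorm : FirstOrderOp N l → ℝ) := by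
  unfold coeffNorm
  fun_prop

end Apply

/-! ### Convergence tested against test functions -/

section Convergence

variable {N : ℕ} {F : Type*} [NormedAddCommGroup F] [NormedSpace ℝ F]

theorem exists_enorm_le (ψ : 𝓓(cube N, ℝ)) : ∃ C : ℝ≥0, ∀ x, ‖ψ x‖ₑ ≤ C := by
  obtain ⟨C, hC⟩ := ψ.hasCompactSupport.exists_bound_of_continuous ψ.contDiff.continuous
  refine ⟨C.toNNReal, fun x => ?_⟩
  rw [← ofReal_norm]
  exact ENNReal.ofReal_le_ofReal (hC x)

theorem tendsto_apply_zero {ι : Type*} {f : Filter ι} {T : ι → 𝓓'(cube N, F)}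
    (h : Tendsto (fun n => measureNorm (T n)) f (𝓝 0)) (ψ : 𝓓(cube N, ℝ)) :
    Tendsto (fun n => T n ψ) f (𝓝 0) := by
  obtain ⟨C, hC⟩ := exists_enorm_le ψ
  rw [tendsto_zero_iff_norm_tendsto_zero]
  have h1 : Tendsto (fun n => ‖T n ψ‖ₑ) f (𝓝 0) := by
    refine tendsto_of_tendsto_of_tendsto_of_le_of_le tendsto_const_nhds ?_ (fun _ => zero_le)
      (fun n => enorm_apply_le (T n) ψ hC)
    simpa using ENNReal.Tendsto.const_mul (a := (C : ℝ≥0∞)) h (Or.inr ENNReal.coe_ne_top)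
  simpa [Function.comp_def, toReal_enorm] using (ENNReal.tendsto_toReal ENNReal.zero_ne_top).comp h1

/-- The restriction of a test function to the cube vanishes at infinity. -/
noncomputable def testToC0 (ψ : 𝓓(cube N, ℝ)) : C₀(cube N, ℝ) where
  toFun x := ψ x
  continuous_toFun := ψ.contDiff.continuous.comp continuous_subtype_val
  zero_at_infty' := by
    have hK : IsCompact (Subtype.val ⁻¹' tsupport ψ : Set (cube N)) := by
      have himage : (Subtype.val '' (Subtype.val ⁻¹' tsupport ψ : Set (cube N)) : Set (Pt N)) =
          tsupport ψ :=
        Set.image_preimage_eq_of_subset fun x hx => ⟨⟨x, ψ.tsupport_subset hx⟩, rfl⟩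
      rw [IsEmbedding.subtypeVal.isCompact_iff, himage]
      exact ψ.hasCompactSupport
    refine tendsto_const_nhds.congr' ?_
    filter_upwards [hK.compl_mem_cocompact] with x hx
    exact (image_eq_zero_of_notMem_tsupport hx).symm

theorem WeakStarTendsto.tendsto_apply {T : ℕ → 𝓓'(cube N, F)} {T' : 𝓓'(cube N, F)}
    (h : WeakStarTendsto T T') (ψ : 𝓓(cube N, ℝ)) : Tendsto (fun n => T n ψ) atTop (𝓝 (T' ψ)) := by
  obtain ⟨μ, μ', hμ, hμ', hφ⟩ := h
  have := hφ (testToC0 ψ)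
  rw [hμ'.2]
  simp only [(hμ _).2]
  exact this

variable [CompleteSpace F]

theorem tendsto_toDistr_apply {ι : Type*} {f : Filter ι} {v : ι → L1Q N F} {v₀ : L1Q N F}
    (h : Tendsto v f (𝓝 v₀)) (ψ : 𝓓(cube N, ℝ)) :
    Tendsto (fun n => toDistr (v n) ψ) f (𝓝 (toDistr v₀ ψ)) := by
  have h1 : Tendsto (fun n => measureNorm (toDistr (v n - v₀))) f (𝓝 0) := by
    simp only [measureNorm_toDistr]
    simpa using (h.sub_const v₀).enorm
  have h2 := (tendsto_apply_zero h1 ψ).add_const (toDistr v₀ ψ)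
  rw [zero_add] at h2
  refine h2.congr fun n => ?_
  rw [map_sub]
  exact sub_add_cancel (toDistr (v n) ψ) (toDistr v₀ ψ)

theorem toDistr_injective : Function.Injective (toDistr : L1Q N F → 𝓓'(cube N, F)) := by
  rw [injective_iff_map_eq_zero]
  intro v hv
  have h := IsOpen.ae_eq_zero_of_integral_contDiff_smul_eq_zero (μ := volQ N) (cube N).isOpen
    (locallyIntegrableOn_L1Q v) fun g hg hc hs => by
      have := toDistr_apply v ⟨g, hg, hc, hs⟩
      rw [hv] at this
      exact this.symm
  rw [Lp.eq_zero_iff_ae_eq_zero]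
  filter_upwards [h, ae_restrict_mem (cube N).isOpen.measurableSet] with x hx hxQ
  exact hx hxQ

/-- The derivatives fall on the test function, so coefficients and functions may vary together, with
no bound on the images. -/
theorem tendsto_applyL1_apply {l : ℕ} {ι : Type*} {f : Filter ι} {B : ι → FirstOrderOp N l}
    {B₀ : FirstOrderOp N l} {v : ι → L1Q N (Tens N l)} {v₀ : L1Q N (Tens N l)}
    (hB : Tendsto B f (𝓝 B₀)) (h : Tendsto v f (𝓝 v₀)) (ψ : 𝓓(cube N, ℝ)) :
    Tendsto (fun n => applyL1 (B n) (v n) ψ) f (𝓝 (applyL1 B₀ v₀ ψ)) := by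
  simp only [applyL1_apply]
  exact (tendsto_finsetSum _ fun i _ => tendsto_contract (tendsto_pi_nhds.1 hB i)
    (tendsto_toDistr_apply h _)).neg

end Convergence
end PGV

namespace PGV

variable {N k : ℕ}

/-! ### Compactness and the lower bound -/

section ExtZero

theorem FieldTuple.extZero_of_lt (v : FieldTuple N k) {l : ℕ} (h : l < k) :
    FieldTuple.extZero v l = v ⟨l, h⟩ := dif_pos h

theorem FieldTuple.extZero_smul (c : ℝ) (v : FieldTuple N k) (l : ℕ) :
    FieldTuple.extZero (c • v) l = c • FieldTuple.extZero v l := by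
  unfold FieldTuple.extZero
  split <;> simp

theorem FieldTuple.enorm_extZero_le (v : FieldTuple N k) (l : ℕ) :
    ‖FieldTuple.extZero v l‖ₑ ≤ ‖v‖ₑ := by
  unfold FieldTuple.extZero
  split
  · exact ENNReal.coe_le_coe.2 (nnnorm_le_pi_nnnorm v _)
  · simp

theorem FieldTuple.tendsto_extZero {ι : Type*} {f : Filter ι} {v : ι → FieldTuple N k}
    {v₀ : FieldTuple N k} (h : Tendsto v f (𝓝 v₀)) (l : ℕ) :
    Tendsto (fun n => FieldTuple.extZero (v n) l) f (𝓝 (FieldTuple.extZero v₀ l)) := by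
  unfold FieldTuple.extZero
  split
  · exact tendsto_pi_nhds.1 h _
  · exact tendsto_const_nhds

end ExtZero

/-- The compactness assumption treats one component at a time; induction over the components
extracts successive subsequences. -/
theorem exists_subseq_tendsto_of_bvOpNorm_le {Bn : ℕ → OpTuple N k} {B : OpTuple N k}
    (hBn : ∀ n l, IsBasic (Bn n l)) (hB : ∀ l, Tendsto (fun n => Bn n l) atTop (𝓝 (B l)))
    (hcomp : ∀ l, IsCompactCollection (Set.range fun n => Bn n l))
    {φ : ℕ → ℕ} (hφ : Tendsto φ atTop atTop) {w : ℕ → FieldTuple N k}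
    (hw : ∀ n l, MemBVOp (Bn (φ n) l) (w n l)) {C : ℝ≥0}
    (hC : ∀ n l, bvOpNorm (Bn (φ n) l) (w n l) ≤ C) :
    ∃ (s : ℕ → ℕ) (w' : FieldTuple N k), StrictMono s ∧ Tendsto (fun n => w (s n)) atTop (𝓝 w') ∧
      ∀ l, MemBVOp (B l) (w' l) := by
  have key : ∀ S : Finset (Fin k), ∃ s : ℕ → ℕ, StrictMono s ∧ ∀ l ∈ S,
      ∃ v', MemBVOp (B l) v' ∧ Tendsto (fun n => w (s n) l) atTop (𝓝 v') := by
    intro S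
    induction S using Finset.cons_induction with
    | empty => exact ⟨id, strictMono_id, by simp⟩
    | cons a S ha ih =>
      obtain ⟨s, hs, hS⟩ := ih
      obtain ⟨D, hD⟩ := ((continuous_coeffNorm.tendsto _).comp (hB a)).bddAbove_range
      have hbound : ∃ C : ℝ≥0, ∀ n, ENNReal.ofReal (coeffNorm (Bn (φ (s n)) a)) +
          bvOpNorm (Bn (φ (s n)) a) (w (s n) a) ≤ C := by
        refine ⟨D.toNNReal + C, fun n => ?_⟩
        rw [ENNReal.coe_add]
        exact add_le_add (ENNReal.ofReal_le_ofReal (hD ⟨_, rfl⟩)) (hC _ _)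
      obtain ⟨B', v', s', hs', hv', hlim, hweak⟩ := hcomp a (fun n => Bn (φ (s n)) a)
        (fun n => w (s n) a) (fun n => ⟨_, rfl⟩) (fun n => hBn _ _) (fun n => hw _ _) hbound
      -- The assumption provides an unspecified `B'`. The images converge on test functions to both
      -- `B' v'` and `B a v'`, so the operators agree on `v'`, which is all that membership
      -- requires.
      have heq : applyL1 B' v' = applyL1 (B a) v' := by
        ext1 ψ
        exact tendsto_nhds_unique (hweak.tendsto_apply ψ) (tendsto_applyL1_apply
          ((hB a).comp (hφ.comp (hs.tendsto_atTop.comp hs'.tendsto_atTop))) hlim ψ)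
      refine ⟨s ∘ s', hs.comp hs', fun l hl => ?_⟩
      rcases Finset.mem_cons.1 hl with rfl | hl
      · refine ⟨v', ?_, hlim⟩
        rw [MemBVOp, ← heq]
        exact hv'
      · obtain ⟨v'', h1, h2⟩ := hS l hl
        exact ⟨v'', h1, h2.comp hs'.tendsto_atTop⟩
  obtain ⟨s, hs, h⟩ := key Finset.univ
  choose w' hw' hlim using fun l => h l (Finset.mem_univ l)
  exact ⟨s, w', hs, tendsto_pi_nhds.2 hlim, hw'⟩

/-- Write `𝓑^l v_l = v_{l+1} - (v_{l+1} - 𝓑^l v_l)`. The factor 2 counts `v_l` and `v_{l+1}`, each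
bounded by the sup norm of the tuple. -/
theorem bvOpNorm_le (B : OpTuple N k) (v : FieldTuple N k) (l : Fin k)
    (hv : MemBVOp (B l) (v l)) : bvOpNorm (B l) (v l) ≤ 2 * ‖v‖ₑ +
      measureNorm (toDistr (FieldTuple.extZero v (l + 1)) - applyL1 (B l) (v l)) := by
  have h1 : measureNorm (applyL1 (B l) (v l)) ≤ ‖FieldTuple.extZero v (l + 1)‖ₑ +
      measureNorm (toDistr (FieldTuple.extZero v (l + 1)) - applyL1 (B l) (v l)) := by
    have := ((isBoundedMeasure_toDistr (FieldTuple.extZero v (l + 1))).sub hv).measureNorm_sub_le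
      (T := toDistr (FieldTuple.extZero v (l + 1)))
    rwa [sub_sub_cancel, measureNorm_toDistr] at this
  rw [bvOpNorm, two_mul, add_assoc ‖v‖ₑ]
  refine add_le_add ?_ (h1.trans ?_)
  · exact ENNReal.coe_le_coe.2 (nnnorm_le_pi_nnnorm v l)
  · gcongr
    exact FieldTuple.enorm_extZero_le v _

/-- The defects whose norms make up the energy are bounded by `C`. -/
def DefectsLE (B : OpTuple N k) (u : L1Q N ℝ) (v : FieldTuple N k) (C : ℝ≥0∞) : Prop :=
  measureNorm (grad N (toDistr u) - toDistr (FieldTuple.extZero v 0)) ≤ C ∧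
  ∀ l : Fin k, measureNorm (toDistr (FieldTuple.extZero v (l + 1)) - applyL1 (B l) (v l)) ≤ C

/-- Blow-up argument: along a subsequence of diverging norms, rescale to norm one. The defects are
linear in `Du` and `v` together, so the rescaled defects vanish in the limit, and the fixed `Du`
disappears as well. -/
theorem exists_norm_le_of_defectsLE {Bn : ℕ → OpTuple N k} {B : OpTuple N k}
    (hBn : ∀ n l, IsBasic (Bn n l)) (hB : ∀ l, Tendsto (fun n => Bn n l) atTop (𝓝 (B l)))
    (hcomp : ∀ l, IsCompactCollection (Set.range fun n => Bn n l)) {u : L1Q N ℝ}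
    {φ : ℕ → ℕ} (hφ : Tendsto φ atTop atTop) {v : ℕ → FieldTuple N k}
    (hv : ∀ n l, MemBVOp (Bn (φ n) l) (v n l)) {C : ℝ≥0}
    (hC : ∀ n, DefectsLE (Bn (φ n)) u (v n) C) : ∃ R : ℝ, ∀ n, ‖v n‖ ≤ R := by
  by_contra! hunb
  -- A bound valid for all large indices would bound the whole sequence. The threshold `n + 1` makes
  -- the scaling factors at most one and forces them to zero.
  have hfreq : ∀ n : ℕ, ∃ᶠ m in atTop, (n : ℝ) + 1 < ‖v m‖ := by
    intro n h
    have hb : IsBoundedUnder (· ≤ ·) atTop fun m => ‖v m‖ :=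
      ⟨n + 1, by simpa using h⟩
    obtain ⟨R, hR⟩ := hb.bddAbove_range
    obtain ⟨m, hm⟩ := hunb R
    exact hm.not_ge (hR ⟨m, rfl⟩)
  obtain ⟨ρ, hρ, hlarge⟩ := extraction_forall_of_frequently hfreq
  have hpos : ∀ n, 0 < ‖v (ρ n)‖ := fun n => lt_trans (by positivity) (hlarge n)
  set c : ℕ → ℝ := fun n => ‖v (ρ n)‖⁻¹ with hc
  set w : ℕ → FieldTuple N k := fun n => c n • v (ρ n) with hwdef
  have hwl : ∀ n l, w n l = c n • v (ρ n) l := fun _ _ => rfl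
  have hc0 : Tendsto c atTop (𝓝 0) := by
    refine tendsto_inv_atTop_zero.comp (tendsto_atTop_mono (fun n => ?_)
      tendsto_natCast_atTop_atTop)
    linarith [hlarge n]
  have hc1 : ∀ n, ‖c n‖ₑ ≤ 1 := by
    intro n
    rw [← ofReal_norm, ← ENNReal.ofReal_one]
    refine ENNReal.ofReal_le_ofReal ?_
    rw [Real.norm_of_nonneg (inv_nonneg.2 (hpos n).le)]
    exact inv_le_one_of_one_le₀ (by linarith [hlarge n, (Nat.cast_nonneg n : (0 : ℝ) ≤ n)])
  have hw1 : ∀ n, ‖w n‖ = 1 := by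
    intro n
    rw [hwdef, norm_smul, Real.norm_of_nonneg (inv_nonneg.2 (hpos n).le),
      inv_mul_cancel₀ (hpos n).ne']
  have hd0 : ∀ n, measureNorm (c n • grad N (toDistr u) - toDistr (FieldTuple.extZero (w n) 0)) ≤
      ‖c n‖ₑ * C := by
    intro n
    have hle := (hC (ρ n)).1
    have hsmul : c n • grad N (toDistr u) - toDistr (FieldTuple.extZero (w n) 0) =
        c n • (grad N (toDistr u) - toDistr (FieldTuple.extZero (v (ρ n)) 0)) := by
      rw [hwdef, FieldTuple.extZero_smul, map_smul]
      exact (smul_sub _ _ _).symm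
    rw [hsmul, (isBoundedMeasure_of_measureNorm_ne_top
      (ne_top_of_le_ne_top ENNReal.coe_ne_top hle)).measureNorm_smul]
    gcongr
  have hd : ∀ n (l : Fin k), measureNorm (toDistr (FieldTuple.extZero (w n) (l + 1)) -
      applyL1 (Bn (φ (ρ n)) l) (w n l)) ≤ ‖c n‖ₑ * C := by
    intro n l
    have hle := (hC (ρ n)).2 l
    rw [hwl, hwdef, FieldTuple.extZero_smul, map_smul, map_smul, ← smul_sub,
      (isBoundedMeasure_of_measureNorm_ne_top
        (ne_top_of_le_ne_top ENNReal.coe_ne_top hle)).measureNorm_smul]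
    gcongr
  have hlim0 : Tendsto (fun n => ‖c n‖ₑ * (C : ℝ≥0∞)) atTop (𝓝 0) := by
    have := ENNReal.Tendsto.mul_const (b := (C : ℝ≥0∞)) hc0.enorm (Or.inr ENNReal.coe_ne_top)
    simpa using this
  have hmem : ∀ n l, MemBVOp (Bn (φ (ρ n)) l) (w n l) := by
    intro n l
    rw [MemBVOp, hwl, map_smul]
    exact (hv (ρ n) l).smul _
  obtain ⟨s, w', hs, hlim, hw'⟩ := exists_subseq_tendsto_of_bvOpNorm_le hBn hB hcomp
    (hφ.comp hρ.tendsto_atTop) hmem (C := 2 + C) fun n l => by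
      refine (bvOpNorm_le _ _ l (hmem n l)).trans ?_
      rw [ENNReal.coe_add]
      refine add_le_add ?_ ((hd n l).trans (mul_le_of_le_one_left zero_le (hc1 n)))
      rw [← ofReal_norm, hw1]
      simp
  have hφ' : Tendsto (fun n => φ (ρ (s n))) atTop atTop :=
    hφ.comp (hρ.tendsto_atTop.comp hs.tendsto_atTop)
  have hz0 : FieldTuple.extZero w' 0 = 0 := by
    refine toDistr_injective ?_
    rw [map_zero]
    ext1 ψ
    have h1 := (tendsto_toDistr_apply (FieldTuple.tendsto_extZero hlim 0) ψ)
    have h2 := tendsto_apply_zero (tendsto_of_tendsto_of_tendsto_of_le_of_le tendsto_const_nhds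
      (hlim0.comp hs.tendsto_atTop) (fun _ => zero_le) fun n => hd0 (s n)) ψ
    have h3 : Tendsto (fun n => c (s n) • grad N (toDistr u) ψ) atTop (𝓝 0) := by
      simpa using (hc0.comp hs.tendsto_atTop).smul_const (grad N (toDistr u) ψ)
    have h4 := h3.sub h2
    rw [sub_zero] at h4
    refine tendsto_nhds_unique h1 (h4.congr fun n => ?_)
    exact sub_sub_cancel _ _
  have hzs : ∀ l : Fin k, toDistr (FieldTuple.extZero w' (l + 1)) = applyL1 (B l) (w' l) := by
    intro l
    ext1 ψ
    have h1 := (tendsto_toDistr_apply (FieldTuple.tendsto_extZero hlim (l + 1)) ψ)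
    have h2 := tendsto_apply_zero (tendsto_of_tendsto_of_tendsto_of_le_of_le tendsto_const_nhds
      (hlim0.comp hs.tendsto_atTop) (fun _ => zero_le) fun n => hd (s n) l) ψ
    have h3 := tendsto_applyL1_apply ((hB l).comp hφ') (tendsto_pi_nhds.1 hlim l) ψ
    have h4 := h2.add h3
    rw [zero_add] at h4
    refine tendsto_nhds_unique h1 (h4.congr fun n => ?_)
    exact sub_add_cancel _ _
  -- The vanishing of the component 0 propagates along `v_{l+1} = 𝓑^l v_l`; beyond index `k - 1` the
  -- extension is zero by definition.
  have hz : ∀ l : ℕ, FieldTuple.extZero w' l = 0 := by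
    intro l
    induction l with
    | zero => exact hz0
    | succ l ih =>
      by_cases hl : l < k
      · refine toDistr_injective ?_
        rw [hzs ⟨l, hl⟩, map_zero]
        rw [FieldTuple.extZero_of_lt _ hl] at ih
        rw [ih, map_zero]
      · exact dif_neg fun h => hl (Nat.lt_of_succ_lt h)
  have hw0 : w' = 0 := by
    ext1 l
    rw [← FieldTuple.extZero_of_lt w' l.2]
    exact hz l
  have hnorm := hlim.norm
  simp only [hw1, hw0, norm_zero] at hnorm
  exact one_ne_zero (tendsto_nhds_unique tendsto_const_nhds hnorm)

/-- Fatou's lemma for the counting measure. -/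
theorem sum_liminf_le {ι : Type*} [Fintype ι] (f : ℕ → ι → ℝ≥0∞) :
    ∑ i, liminf (fun n => f n i) atTop ≤ liminf (fun n => ∑ i, f n i) atTop := by
  let _ : MeasurableSpace ι := ⊤
  have := lintegral_liminf_le (μ := Measure.count) (f := f) (u := atTop)
    fun n => measurable_from_top
  simpa [lintegral_count] using this

theorem exists_energy_le {Bn : ℕ → OpTuple N k} {B : OpTuple N k}
    {αn : ℕ → Fin (k + 1) → ℝ} {α : Fin (k + 1) → ℝ}
    (hBn : ∀ n l, IsBasic (Bn n l)) (hB : ∀ l, Tendsto (fun n => Bn n l) atTop (𝓝 (B l)))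
    (hαn : ∀ n i, 0 < αn n i) (hα : ∀ i, 0 < α i) (hα_lim : Tendsto αn atTop (𝓝 α))
    (hcomp : ∀ l, IsCompactCollection (Set.range fun n => Bn n l)) {u : L1Q N ℝ} (hu : MemBV u)
    {φ : ℕ → ℕ} (hφ : Tendsto φ atTop atTop) {v : ℕ → FieldTuple N k}
    (hv : ∀ n l, MemBVOp (Bn (φ n) l) (v n l)) {c : ℝ≥0∞} (hc : c ≠ ⊤)
    (hE : ∀ n, energy (αn (φ n)) (Bn (φ n)) u (v n) ≤ c) :
    ∃ v' : FieldTuple N k, (∀ l, MemBVOp (B l) (v' l)) ∧ energy α B u v' ≤ c := by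
  -- The limit weights are positive, so the inverse weights converge and are uniformly bounded; this
  -- turns an energy bound into bounds on the separate defects.
  obtain ⟨K, hK⟩ : ∃ K : ℝ≥0, ∀ n i, ENNReal.ofReal (αn n i)⁻¹ ≤ K := by
    have h : ∀ i, ∃ K : ℝ, ∀ n, (αn n i)⁻¹ ≤ K := fun i => by
      obtain ⟨K, hK⟩ := ((tendsto_pi_nhds.1 hα_lim i).inv₀ (hα i).ne').bddAbove_range
      exact ⟨K, fun n => hK ⟨n, rfl⟩⟩
    choose K hK using h
    refine ⟨∑ i, (K i).toNNReal, fun n i => ?_⟩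
    refine (ENNReal.ofReal_le_ofReal (hK i n)).trans (ENNReal.coe_le_coe.2 ?_)
    exact Finset.single_le_sum (f := fun i => (K i).toNNReal) (fun _ _ => zero_le)
      (Finset.mem_univ i)
  have hdiv : ∀ (n : ℕ) (i : Fin (k + 1)) (m : ℝ≥0∞), ENNReal.ofReal (αn n i) * m ≤ c →
      m ≤ K * c := by
    intro n i m h
    calc m = ENNReal.ofReal (αn n i)⁻¹ * (ENNReal.ofReal (αn n i) * m) := by
          rw [← mul_assoc, ← ENNReal.ofReal_mul (inv_nonneg.2 (hαn n i).le),
            inv_mul_cancel₀ (hαn n i).ne', ENNReal.ofReal_one, one_mul]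
      _ ≤ K * c := mul_le_mul' (hK n i) h
  have hKc : (K : ℝ≥0∞) * c ≠ ⊤ := ENNReal.mul_ne_top ENNReal.coe_ne_top hc
  have hdef : ∀ n, DefectsLE (Bn (φ n)) u (v n) ((K * c).toNNReal : ℝ≥0) := by
    intro n
    rw [ENNReal.coe_toNNReal hKc]
    refine ⟨hdiv (φ n) 0 _ (le_trans le_self_add (hE n)), fun l => hdiv (φ n) l.succ _ ?_⟩
    refine le_trans ?_ ((le_add_self).trans (hE n))
    exact Finset.single_le_sum (f := fun l : Fin k => ENNReal.ofReal (αn (φ n) l.succ) *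
      measureNorm (toDistr (FieldTuple.extZero (v n) (l + 1)) - applyL1 (Bn (φ n) l) (v n l)))
      (fun _ _ => zero_le) (Finset.mem_univ l)
  obtain ⟨R, hR⟩ := exists_norm_le_of_defectsLE hBn hB hcomp hφ hv hdef
  obtain ⟨s, v', hs, hlim, hv'⟩ := exists_subseq_tendsto_of_bvOpNorm_le hBn hB hcomp
    hφ hv (C := 2 * R.toNNReal + (K * c).toNNReal) fun n l => by
      refine (bvOpNorm_le _ _ l (hv n l)).trans ?_
      rw [ENNReal.coe_add, ENNReal.coe_mul]
      refine add_le_add (mul_le_mul' le_rfl ?_) ((hdef n).2 l)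
      rw [← ofReal_norm]
      exact ENNReal.ofReal_le_ofReal (hR n)
  refine ⟨v', hv', ?_⟩
  have hφ' : Tendsto (fun n => φ (s n)) atTop atTop := hφ.comp hs.tendsto_atTop
  have hα' : ∀ i, Tendsto (fun n => αn (φ (s n)) i) atTop (𝓝 (α i)) := fun i =>
    (tendsto_pi_nhds.1 hα_lim i).comp hφ'
  -- Moving the weight inside the norm lets one semicontinuity statement handle varying weights and
  -- varying defects at once.
  have hscale : ∀ {F : Type} [NormedAddCommGroup F] [NormedSpace ℝ F] [CompleteSpace F]
      {a : ℝ} {T : 𝓓'(cube N, F)}, 0 < a → IsBoundedMeasure T →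
      ENNReal.ofReal a * measureNorm T = measureNorm (a • T) := by
    intro F _ _ _ a T ha hT
    rw [hT.measureNorm_smul, Real.enorm_eq_ofReal ha.le]
  let f : ℕ → Fin (k + 1) → ℝ≥0∞ := fun n => Fin.cons
    (ENNReal.ofReal (αn (φ (s n)) 0) *
      measureNorm (grad N (toDistr u) - toDistr (FieldTuple.extZero (v (s n)) 0)))
    fun l : Fin k => ENNReal.ofReal (αn (φ (s n)) l.succ) * measureNorm
      (toDistr (FieldTuple.extZero (v (s n)) (l + 1)) - applyL1 (Bn (φ (s n)) l) (v (s n) l))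
  have hf : ∀ n, ∑ i, f n i = energy (αn (φ (s n))) (Bn (φ (s n))) u (v (s n)) := fun n => by
    rw [Fin.sum_univ_succ]
    rfl
  have hbd : ∀ v : L1Q N (Tens N 1), IsBoundedMeasure (grad N (toDistr u) - toDistr v) :=
    fun v => hu.sub (isBoundedMeasure_toDistr v)
  have hbd' : ∀ {l : ℕ} {A : FirstOrderOp N l} {v : L1Q N (Tens N l)}
      (w : L1Q N (Tens N (l + 1))), MemBVOp A v → IsBoundedMeasure (toDistr w - applyL1 A v) :=
    fun w h => (isBoundedMeasure_toDistr w).sub h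
  calc energy α B u v' ≤ ∑ i, liminf (fun n => f n i) atTop := by
        rw [Fin.sum_univ_succ, energy]
        refine add_le_add ?_ (Finset.sum_le_sum fun l _ => ?_)
        · rw [hscale (hα 0) (hbd _)]
          refine (((hbd _).smul _).measureNorm_le_liminf fun ψ => ?_).trans_eq
            (liminf_congr (.of_forall fun n => (hscale (hαn _ 0) (hbd _)).symm))
          exact (hα' 0).smul (tendsto_const_nhds.sub
            (tendsto_toDistr_apply (FieldTuple.tendsto_extZero hlim 0) ψ))
        · rw [hscale (hα l.succ) (hbd' _ (hv' l))]
          refine (((hbd' _ (hv' l)).smul _).measureNorm_le_liminf fun ψ => ?_).trans_eq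
            (liminf_congr (.of_forall fun n => (hscale (hαn _ l.succ) (hbd' _ (hv _ l))).symm))
          exact (hα' l.succ).smul ((tendsto_toDistr_apply
            (FieldTuple.tendsto_extZero hlim (l + 1)) ψ).sub
            (tendsto_applyL1_apply ((hB l).comp hφ') (tendsto_pi_nhds.1 hlim l) ψ))
    _ ≤ liminf (fun n => ∑ i, f n i) atTop := sum_liminf_le f
    _ ≤ c := by
        refine liminf_le_of_le (by isBoundedDefault) fun b hb => ?_
        obtain ⟨n, hn⟩ := hb.exists
        exact hn.trans ((hf n).trans_le (hE _))

end PGV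

namespace PGV

/-! ### Averaging over contracted points of the cube -/

open scoped Convolution

theorem norm_le_of_mem_cube {N : ℕ} {x : Pt N} (hx : x ∈ cube N) : ‖x‖ ≤ √N := by
  refine Real.le_sqrt_of_sq_le ?_
  rw [EuclideanSpace.norm_sq_eq]
  calc ∑ i, ‖x i‖ ^ 2 ≤ ∑ _i : Fin N, (1 : ℝ) := by
        refine Finset.sum_le_sum fun i _ => ?_
        have := hx i
        rw [Real.norm_eq_abs, sq_abs]
        simp only [Set.mem_Ioo] at this
        nlinarith
    _ = N := by simp

instance isFiniteMeasure_volQ (N : ℕ) : IsFiniteMeasure (volQ N) := by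
  refine isFiniteMeasure_restrict.2 (ne_top_of_le_ne_top ?_ (measure_mono fun x hx =>
    mem_closedBall_zero_iff.2 (norm_le_of_mem_cube hx)))
  exact measure_closedBall_lt_top.ne

/-- A smooth kernel `η` such that `y - s x` lies outside its support unless `y` is within
`(1 - s) / 2` of `s x`; then `x ∈ Q` forces `y ∈ Q`. -/
structure ScaleKernel (N : ℕ) (s : ℝ) where
  /-- The underlying function. -/
  toFun : Pt N → ℝ
  contDiff : ContDiff ℝ ∞ toFun
  tsupport_subset : tsupport toFun ⊆ Metric.closedBall 0 ((1 - s) / 2)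
  pos : 0 < s

namespace ScaleKernel

variable {N : ℕ} {s : ℝ} (η : ScaleKernel N s)

theorem hasCompactSupport : HasCompactSupport η.toFun :=
  (isCompact_closedBall _ _).of_isClosed_subset (isClosed_tsupport _) η.tsupport_subset

theorem exists_bound : ∃ C, ∀ x, ‖η.toFun x‖ ≤ C :=
  η.hasCompactSupport.exists_bound_of_continuous η.contDiff.continuous

/-- The directional derivative of a kernel. -/
noncomputable def lineDeriv (v : Pt N) : ScaleKernel N s where
  toFun x := fderiv ℝ η.toFun x v
  contDiff := (η.contDiff.fderiv_right (m := ∞) (by simp)).clm_apply contDiff_const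
  tsupport_subset := (tsupport_fderiv_apply_subset ℝ v).trans η.tsupport_subset
  pos := η.pos

/-- Coordinatewise `|s x_i + w_i| < s / 2 + (1 - s) / 2 = 1 / 2`. Hence the averages need no
extension of functions beyond the cube. -/
theorem add_mem_cube (hs : 0 < s) {x w : Pt N} (hx : x ∈ cube N)
    (hw : w ∈ Metric.closedBall (0 : Pt N) ((1 - s) / 2)) : s • x + w ∈ cube N := by
  intro i
  have h1 : |w i| ≤ (1 - s) / 2 := by
    have := (PiLp.norm_apply_le w i).trans (mem_closedBall_zero_iff.1 hw)
    simpa using this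
  have h2 := hx i
  rw [abs_le] at h1
  simp only [PiLp.add_apply, PiLp.smul_apply, smul_eq_mul, Set.mem_Ioo] at h2 ⊢
  constructor <;> nlinarith

/-- The adjoint of the kernel operator, as a function. -/
noncomputable def dualFun (ψ : Pt N → ℝ) (y : Pt N) : ℝ := ∫ x, ψ x * η.toFun (y - s • x)

/-- The substitution `w = s x` produces the Jacobian factor and reduces smoothness and
differentiation to ordinary convolution. -/
theorem dualFun_eq_convolution (ψ : Pt N → ℝ) :
    η.dualFun ψ = fun y => |(s ^ Module.finrank ℝ (Pt N))⁻¹| •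
      ((fun w => ψ (s⁻¹ • w)) ⋆[ContinuousLinearMap.mul ℝ ℝ] η.toFun) y := by
  ext y
  have := Measure.integral_comp_smul volume (fun w => ψ (s⁻¹ • w) * η.toFun (y - w)) s
  simp only [smul_smul, inv_mul_cancel₀ η.pos.ne', one_smul] at this
  rw [dualFun, this]
  rfl

theorem locallyIntegrable_comp_smul {ψ : Pt N → ℝ} (hψ : Continuous ψ) :
    LocallyIntegrable (fun w => ψ (s⁻¹ • w)) (volume : Measure (Pt N)) :=
  (hψ.comp (continuous_const_smul _)).locallyIntegrable

theorem contDiff_dualFun {ψ : Pt N → ℝ} (hψ : Continuous ψ) : ContDiff ℝ ∞ (η.dualFun ψ) := by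
  rw [dualFun_eq_convolution]
  have h : ContDiff ℝ ∞ ((fun w => ψ (s⁻¹ • w)) ⋆[ContinuousLinearMap.mul ℝ ℝ] η.toFun) :=
    η.hasCompactSupport.contDiff_convolution_right (ContinuousLinearMap.mul ℝ ℝ) (n := ⊤)
      (locallyIntegrable_comp_smul hψ) η.contDiff
  exact h.const_smul _

theorem fderiv_dualFun {ψ : Pt N → ℝ} (hψ : Continuous ψ) (y v : Pt N) :
    fderiv ℝ (η.dualFun ψ) y v = (η.lineDeriv v).dualFun ψ y := by
  have hL := locallyIntegrable_comp_smul (s := s) hψ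
  have h1 : ContDiff ℝ 1 η.toFun := η.contDiff.of_le (by simp)
  have h := η.hasCompactSupport.hasFDerivAt_convolution_right (ContinuousLinearMap.mul ℝ ℝ) hL h1 y
  rw [dualFun_eq_convolution, dualFun_eq_convolution, (h.fun_const_smul _).fderiv, smul_apply,
    convolution_precompR_apply _ hL (η.hasCompactSupport.fderiv ℝ)
    (h1.continuous_fderiv (by simp))]
  rfl

theorem tsupport_dualFun_subset {ψ : Pt N → ℝ} (hψ : HasCompactSupport ψ) :
    IsCompact ((fun p : Pt N × Pt N => s • p.1 + p.2) ''
      (tsupport ψ ×ˢ Metric.closedBall 0 ((1 - s) / 2))) ∧ tsupport (η.dualFun ψ) ⊆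
    (fun p : Pt N × Pt N => s • p.1 + p.2) '' (tsupport ψ ×ˢ Metric.closedBall 0 ((1 - s) / 2)) := by
  have hK : IsCompact ((fun p : Pt N × Pt N => s • p.1 + p.2) ''
      (tsupport ψ ×ˢ Metric.closedBall 0 ((1 - s) / 2))) :=
    (IsCompact.prod hψ (isCompact_closedBall _ _)).image (by fun_prop)
  refine ⟨hK, closure_minimal (fun y hy => ?_) hK.isClosed⟩
  by_contra hn
  refine hy (integral_eq_zero_of_ae (.of_forall fun x => ?_))
  by_contra hx
  obtain ⟨h1, h2⟩ := mul_ne_zero_iff.1 hx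
  exact hn ⟨(x, y - s • x), ⟨subset_tsupport _ h1, η.tsupport_subset (subset_tsupport _ h2)⟩,
    by simp⟩

/-- The adjoint of the kernel operator, acting on test functions on the cube. -/
noncomputable def dual (ψ : 𝓓(cube N, ℝ)) : 𝓓(cube N, ℝ) where
  toFun := η.dualFun ψ
  contDiff' := η.contDiff_dualFun ψ.contDiff.continuous
  hasCompactSupport' := (η.tsupport_dualFun_subset ψ.hasCompactSupport).1.of_isClosed_subset
    (isClosed_tsupport _) (η.tsupport_dualFun_subset ψ.hasCompactSupport).2
  tsupport_subset' := (η.tsupport_dualFun_subset ψ.hasCompactSupport).2.trans <| by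
    rintro _ ⟨p, ⟨h1, h2⟩, rfl⟩
    exact add_mem_cube η.pos (ψ.tsupport_subset h1) h2

theorem dual_apply (ψ : 𝓓(cube N, ℝ)) (y : Pt N) :
    η.dual ψ y = ∫ x, ψ x * η.toFun (y - s • x) := rfl

theorem _root_.PGV.lineDerivOp_apply (ψ : 𝓓(cube N, ℝ)) (v x : Pt N) :
    (∂_{v} ψ : 𝓓(cube N, ℝ)) x = fderiv ℝ ψ x v := by
  rw [TestFunction.lineDerivOp_eq_lineDerivCLM ℝ, TestFunction.lineDerivCLM_apply_of_le (by simp)]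
  exact (ψ.contDiff.differentiable (by simp) x).lineDeriv_eq_fderiv

theorem lineDerivOp_dual (ψ : 𝓓(cube N, ℝ)) (v : Pt N) :
    ∂_{v} (η.dual ψ) = (η.lineDeriv v).dual ψ := by
  ext y
  rw [lineDerivOp_apply]
  exact η.fderiv_dualFun ψ.contDiff.continuous y v

theorem integrable_mul_comp (ψ : 𝓓(cube N, ℝ)) (y : Pt N) :
    Integrable (fun x => ψ x * η.toFun (y - s • x)) := by
  have h1 := η.contDiff.continuous
  have h2 := ψ.contDiff.continuous
  exact (by fun_prop : Continuous fun x => ψ x * η.toFun (y - s • x)).integrable_of_hasCompactSupport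
    ψ.hasCompactSupport.mul_right

/-- Integration by parts in `x`; the chain rule on `η (y - s x)` supplies the factor `s`. Together
with `lineDerivOp_dual`, the adjoint commutes with derivatives up to this factor. -/
theorem dual_lineDerivOp (ψ : 𝓓(cube N, ℝ)) (v : Pt N) :
    η.dual (∂_{v} ψ) = s • (η.lineDeriv v).dual ψ := by
  ext y
  change η.dual (∂_{v} ψ) y = s * (η.lineDeriv v).dual ψ y
  have hdη : Differentiable ℝ η.toFun := η.contDiff.differentiable (by simp)
  have hd : ∀ x, HasFDerivAt (fun x => η.toFun (y - s • x))
      ((fderiv ℝ η.toFun (y - s • x)).comp (-(s • ContinuousLinearMap.id ℝ (Pt N)))) x := fun x =>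
    (hdη _).hasFDerivAt.comp x (((hasFDerivAt_id x).const_smul s).const_sub y)
  have hd' : ∀ x, fderiv ℝ (fun x => η.toFun (y - s • x)) x v =
      -(s * (η.lineDeriv v).toFun (y - s • x)) := fun x => by
    rw [(hd x).fderiv]
    simp [lineDeriv]
  have hp := integral_mul_fderiv_eq_neg_fderiv_mul_of_integrable (μ := volume) (f := ψ)
    (g := fun x => η.toFun (y - s • x)) (v := v) ?_ ?_ (η.integrable_mul_comp ψ y)
    (fun x _ => ψ.contDiff.differentiable (by simp) x) (fun x _ => (hd x).differentiableAt)
  · simp only [hd', ← lineDerivOp_apply] at hp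
    rw [dual_apply, dual_apply, ← integral_const_mul, ← neg_eq_iff_eq_neg.2 hp, ← integral_neg]
    congr 1 with x
    ring
  · simp only [← lineDerivOp_apply]
    exact η.integrable_mul_comp _ y
  · simp only [hd']
    refine (((η.lineDeriv v).integrable_mul_comp ψ y).const_mul (-s)).congr (.of_forall fun x => ?_)
    simp only
    ring

section Operator

variable {F : Type*} [NormedAddCommGroup F] [NormedSpace ℝ F]

theorem integrable_prod (f : L1Q N F) :
    Integrable (fun p : Pt N × Pt N => η.toFun (p.2 - s • p.1) • f p.2)
      ((volQ N).prod (volQ N)) := by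
  obtain ⟨C, hC⟩ := η.exists_bound
  refine ((L1.integrable_coeFn f).comp_snd (volQ N)).bdd_smul C ?_ (.of_forall fun p => hC _)
  have := η.contDiff.continuous
  exact (by fun_prop : Continuous fun p : Pt N × Pt N =>
    η.toFun (p.2 - s • p.1)).aestronglyMeasurable

/-- The kernel operator `f ↦ ∫_Q η(y - s x) f(y) dy` on `L¹(Q)`. -/
noncomputable def conv (f : L1Q N F) : L1Q N F :=
  ((η.integrable_prod f).integral_prod_left).toL1 _

theorem coeFn_conv (f : L1Q N F) :
    η.conv f =ᵐ[volQ N] fun x => ∫ y in (cube N : Set (Pt N)), η.toFun (y - s • x) • f y :=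
  Integrable.coeFn_toL1 _

/-- Fubini. The later identities and bounds for `conv` are transferred to test functions through
this duality. -/
theorem toDistr_conv [CompleteSpace F] (f : L1Q N F) (ψ : 𝓓(cube N, ℝ)) :
    toDistr (η.conv f) ψ = toDistr f (η.dual ψ) := by
  rw [toDistr_apply, toDistr_apply]
  calc ∫ x in (cube N : Set (Pt N)), ψ x • η.conv f x
      = ∫ x in (cube N : Set (Pt N)), ∫ y in (cube N : Set (Pt N)),
          ψ x • η.toFun (y - s • x) • f y := by
        refine integral_congr_ae ?_
        filter_upwards [η.coeFn_conv f] with x hx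
        rw [hx, integral_smul]
    _ = ∫ y in (cube N : Set (Pt N)), ∫ x in (cube N : Set (Pt N)),
          ψ x • η.toFun (y - s • x) • f y := by
        refine integral_integral_swap ?_
        obtain ⟨C, hC⟩ := ψ.hasCompactSupport.exists_bound_of_continuous ψ.contDiff.continuous
        exact (η.integrable_prod f).bdd_smul (φ := fun p => ψ p.1) C
          (ψ.contDiff.continuous.comp continuous_fst).aestronglyMeasurable
          (.of_forall fun p => hC _)
    _ = ∫ y in (cube N : Set (Pt N)), η.dual ψ y • f y := by
        congr 1 with y
        simp only [smul_smul]
        rw [integral_smul_const, dual_apply, setIntegral_eq_integral_of_forall_compl_eq_zero]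
        intro x hx
        rw [image_eq_zero_of_notMem_tsupport fun h => hx (ψ.tsupport_subset h), zero_mul]

variable [CompleteSpace F]

theorem conv_sub (f g : L1Q N F) : η.conv (f - g) = η.conv f - η.conv g := by
  refine toDistr_injective ?_
  ext1 ψ
  rw [map_sub]
  change _ = toDistr (η.conv f) ψ - toDistr (η.conv g) ψ
  simp only [toDistr_conv, map_sub]
  rfl

theorem conv_zero : η.conv (0 : L1Q N F) = 0 := by
  simpa using η.conv_sub (0 : L1Q N F) 0

/-- Here the derivative stays on `f`, which preserves the defects; in the primed version it falls on
the kernel, which shows that derivatives of averages are `L¹` functions. -/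
theorem toDistr_conv_lineDerivOp (f : L1Q N F) (ψ : 𝓓(cube N, ℝ)) (v : Pt N) :
    toDistr (η.conv f) (∂_{v} ψ) = s • toDistr f (∂_{v} (η.dual ψ)) := by
  rw [toDistr_conv, dual_lineDerivOp, map_smul, lineDerivOp_dual]

theorem toDistr_conv_lineDerivOp' (f : L1Q N F) (ψ : 𝓓(cube N, ℝ)) (v : Pt N) :
    toDistr (η.conv f) (∂_{v} ψ) = s • toDistr ((η.lineDeriv v).conv f) ψ := by
  rw [toDistr_conv, dual_lineDerivOp, map_smul, toDistr_conv]

end Operator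

section Normalized

variable {F : Type*} [NormedAddCommGroup F] [NormedSpace ℝ F]

/-- The kernel is a probability density. -/
structure IsNormalized : Prop where
  nonneg : ∀ x, 0 ≤ η.toFun x
  integral_eq_one : ∫ x, η.toFun x = 1

variable {η}

theorem IsNormalized.integral_comp (h : η.IsNormalized) (y : Pt N) :
    ∫ x, η.toFun (y - s • x) = |(s ^ Module.finrank ℝ (Pt N))⁻¹| := by
  rw [Measure.integral_comp_smul volume (fun w => η.toFun (y - w)) s,
    integral_sub_left_eq_self η.toFun volume y, h.integral_eq_one, smul_eq_mul, mul_one]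

/-- The adjoint maps families admissible for the total variation to such families up to the mass of
`x ↦ η (y - s x)`, the inverse of `s` to the power of the dimension. -/
theorem IsNormalized.sum_enorm_dual_le (h : η.IsNormalized) {ι : Type*} (S : Finset ι)
    (ψ : ι → 𝓓(cube N, ℝ)) (hψ : ∀ x, ∑ i ∈ S, ‖ψ i x‖ₑ ≤ 1) (y : Pt N) :
    ∑ i ∈ S, ‖η.dual (ψ i) y‖ₑ ≤ ENNReal.ofReal |(s ^ Module.finrank ℝ (Pt N))⁻¹| := by
  have hη := η.contDiff.continuous
  have hc : Continuous fun x : Pt N => η.toFun (y - s • x) := by fun_prop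
  have hint : Integrable fun x : Pt N => η.toFun (y - s • x) := by
    refine .of_integral_ne_zero ?_
    rw [h.integral_comp]
    have := η.pos
    positivity
  calc ∑ i ∈ S, ‖η.dual (ψ i) y‖ₑ ≤ ∑ i ∈ S, ∫⁻ x, ‖ψ i x * η.toFun (y - s • x)‖ₑ :=
        Finset.sum_le_sum fun i _ => enorm_integral_le_lintegral_enorm _
    _ = ∫⁻ x, ∑ i ∈ S, ‖ψ i x * η.toFun (y - s • x)‖ₑ := by
        rw [lintegral_finsetSum]
        exact fun i _ => ((ψ i).contDiff.continuous.mul hc).measurable.enorm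
    _ ≤ ∫⁻ x, ‖η.toFun (y - s • x)‖ₑ := by
        refine lintegral_mono fun x => ?_
        simp only [enorm_mul, ← Finset.sum_mul]
        exact mul_le_of_le_one_left zero_le (hψ x)
    _ = _ := by
        rw [← h.integral_comp y, ofReal_integral_eq_lintegral_ofReal hint
          (.of_forall fun x => h.nonneg _)]
        simp only [Real.enorm_eq_ofReal (h.nonneg _)]

theorem IsNormalized.sum_enorm_apply_dual_le (h : η.IsNormalized) (T : 𝓓'(cube N, F)) {ι : Type*}
    (S : Finset ι) (ψ : ι → 𝓓(cube N, ℝ)) (hψ : ∀ x, ∑ i ∈ S, ‖ψ i x‖ₑ ≤ 1) :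
    ∑ i ∈ S, ‖T (η.dual (ψ i))‖ₑ ≤
      ENNReal.ofReal |(s ^ Module.finrank ℝ (Pt N))⁻¹| * measureNorm T :=
  sum_enorm_apply_le S (fun i => η.dual (ψ i)) (h.sum_enorm_dual_le S ψ hψ) ENNReal.ofReal_ne_top

theorem IsNormalized.enorm_conv_le [CompleteSpace F] (h : η.IsNormalized) (f : L1Q N F) :
    ‖η.conv f‖ₑ ≤ ENNReal.ofReal |(s ^ Module.finrank ℝ (Pt N))⁻¹| * ‖f‖ₑ := by
  rw [← measureNorm_toDistr, ← measureNorm_toDistr f]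
  refine (isBoundedMeasure_toDistr _).measureNorm_le_of_forall fun P ψ hψ => ?_
  simp only [toDistr_conv]
  exact h.sum_enorm_apply_dual_le _ P ψ hψ

end Normalized

section FirstOrder

variable {l : ℕ}

/-- The function representing `𝓑` applied to a kernel average. -/
noncomputable def applyConv (B : FirstOrderOp N l) (f : L1Q N (Tens N l)) :
    L1Q N (Tens N (l + 1)) :=
  -(s • ∑ i, (contract (B i)).compLp ((η.lineDeriv (basisVec i)).conv f))

theorem _root_.PGV.toDistr_compLp {E F : Type*} [NormedAddCommGroup E] [NormedSpace ℝ E]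
    [CompleteSpace E] [NormedAddCommGroup F] [NormedSpace ℝ F] [CompleteSpace F]
    (A : E →L[ℝ] F) (f : L1Q N E) (ψ : 𝓓(cube N, ℝ)) :
    toDistr (A.compLp f) ψ = A (toDistr f ψ) := by
  rw [toDistr_apply, toDistr_apply, ← A.integral_comp_comm (integrable_test_smul ψ f)]
  refine integral_congr_ae ?_
  filter_upwards [A.coeFn_compLp f] with x hx
  rw [hx, map_smul]

theorem applyL1_conv (B : FirstOrderOp N l) (f : L1Q N (Tens N l)) :
    applyL1 B (η.conv f) = toDistr (η.applyConv B f) := by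
  ext1 ψ
  rw [applyL1_apply, applyConv, map_neg, map_smul, map_sum]
  change _ = -(s • (∑ i, toDistr ((contract (B i)).compLp
    ((η.lineDeriv (basisVec i)).conv f)) : 𝓓'(cube N, Tens N (l + 1))) ψ)
  rw [sum_apply, Finset.smul_sum]
  simp only [toDistr_conv_lineDerivOp', map_smul, toDistr_compLp]

theorem applyL1_conv_apply (B : FirstOrderOp N l) (f : L1Q N (Tens N l)) (ψ : 𝓓(cube N, ℝ)) :
    applyL1 B (η.conv f) ψ = s • applyL1 B f (η.dual ψ) := by
  simp only [applyL1_apply, toDistr_conv_lineDerivOp, map_smul, smul_neg, Finset.smul_sum]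

/-- The constant depends on the kernel and on `f` but not on `B`, so a fixed average can serve for a
whole sequence of operators. -/
theorem exists_measureNorm_applyL1_conv_le (f : L1Q N (Tens N l)) :
    ∃ C : ℝ≥0, ∀ B : FirstOrderOp N l,
      measureNorm (applyL1 B (η.conv f)) ≤ ENNReal.ofReal (coeffNorm B) * C := by
  refine ⟨(s * ∑ i, ‖(η.lineDeriv (basisVec i)).conv f‖).toNNReal, fun B => ?_⟩
  rw [applyL1_conv, measureNorm_toDistr, ← ofReal_norm]
  have hC : 0 ≤ coeffNorm B := Finset.sum_nonneg fun _ _ => norm_nonneg _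
  change _ ≤ ENNReal.ofReal _ * ENNReal.ofReal _
  rw [← ENNReal.ofReal_mul hC]
  refine ENNReal.ofReal_le_ofReal ?_
  rw [applyConv, norm_neg, norm_smul, Real.norm_of_nonneg η.pos.le, mul_left_comm]
  refine mul_le_mul_of_nonneg_left ((norm_sum_le _ _).trans ?_) η.pos.le
  rw [Finset.mul_sum]
  refine Finset.sum_le_sum fun i _ => (ContinuousLinearMap.norm_compLp_le _ _).trans ?_
  gcongr
  refine (ContinuousLinearMap.opNorm_le_bound _ (norm_nonneg _)
    (norm_contract_apply_le (B i))).trans ?_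
  exact Finset.single_le_sum (f := fun i => ‖B i‖) (fun _ _ => norm_nonneg _) (Finset.mem_univ i)

variable {η}

/-- `𝓑` applied to an average carries a factor `s` that the average of `g` lacks. Splitting the
latter into its `1 - s` and `s` multiples leaves `s` times the dual action of the original defect
and a small `L¹` error. -/
theorem IsNormalized.measureNorm_defect_le (h : η.IsNormalized) (hs : s ≤ 1)
    (B : FirstOrderOp N l) (f : L1Q N (Tens N l)) (g : L1Q N (Tens N (l + 1))) :
    measureNorm (toDistr (η.conv g) - applyL1 B (η.conv f)) ≤
      ENNReal.ofReal (1 - s) * ‖η.conv g‖ₑ + ENNReal.ofReal s *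
        (ENNReal.ofReal |(s ^ Module.finrank ℝ (Pt N))⁻¹| *
          measureNorm (toDistr g - applyL1 B f)) := by
  have hb : IsBoundedMeasure (toDistr (η.conv g) - applyL1 B (η.conv f)) := by
    rw [applyL1_conv]
    exact (isBoundedMeasure_toDistr _).sub (isBoundedMeasure_toDistr _)
  refine hb.measureNorm_le_of_forall fun P ψ hψ => ?_
  have heq : ∀ i, (toDistr (η.conv g) - applyL1 B (η.conv f)) (ψ i) =
      (1 - s) • toDistr (η.conv g) (ψ i) + s • (toDistr g - applyL1 B f) (η.dual (ψ i)) := by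
    intro i
    change toDistr (η.conv g) (ψ i) - applyL1 B (η.conv f) (ψ i) = _ +
      s • (toDistr g (η.dual (ψ i)) - applyL1 B f (η.dual (ψ i)))
    rw [applyL1_conv_apply, toDistr_conv, sub_smul, one_smul, smul_sub]
    abel
  calc ∑ i ∈ P, ‖(toDistr (η.conv g) - applyL1 B (η.conv f)) (ψ i)‖ₑ
      ≤ ∑ i ∈ P, (ENNReal.ofReal (1 - s) * ‖toDistr (η.conv g) (ψ i)‖ₑ +
        ENNReal.ofReal s * ‖(toDistr g - applyL1 B f) (η.dual (ψ i))‖ₑ) := by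
        refine Finset.sum_le_sum fun i _ => ?_
        rw [heq]
        refine (enorm_add_le _ _).trans_eq ?_
        rw [enorm_smul, enorm_smul, Real.enorm_eq_ofReal (sub_nonneg.2 hs),
          Real.enorm_eq_ofReal η.pos.le]
    _ ≤ _ := by
        rw [Finset.sum_add_distrib, ← Finset.mul_sum, ← Finset.mul_sum]
        gcongr
        · rw [← measureNorm_toDistr]
          simpa using sum_enorm_apply_le (T := toDistr (η.conv g)) P ψ hψ ENNReal.one_ne_top
        · exact h.sum_enorm_apply_dual_le _ P ψ hψ

end FirstOrder

end ScaleKernel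
end PGV

namespace PGV

/-! ### Convergence of the averages in `L¹` -/

open scoped Convolution

/-- A sequence of dilation factors increasing to `1`. -/
noncomputable def dilation (n : ℕ) : ℝ := 1 - 1 / (n + 2)

theorem dilation_pos (n : ℕ) : 0 < dilation n := by
  have : (1 : ℝ) / (n + 2) < 1 := by
    rw [div_lt_one (by positivity)]
    linarith [(Nat.cast_nonneg n : (0 : ℝ) ≤ n)]
  simpa [dilation] using this

theorem dilation_le_one (n : ℕ) : dilation n ≤ 1 := by
  have : (0 : ℝ) ≤ 1 / (n + 2) := by positivity
  simpa [dilation] using this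

theorem tendsto_dilation : Tendsto dilation atTop (𝓝 1) := by
  have h : Tendsto (fun n : ℕ => (1 : ℝ) / ((n : ℝ) + 2)) atTop (𝓝 0) :=
    tendsto_const_nhds.div_atTop (tendsto_atTop_add_const_right _ _ tendsto_natCast_atTop_atTop)
  have h1 := h.const_sub 1
  rw [sub_zero] at h1
  exact h1

/-- Bumps whose radius is half the dilation defect. -/
noncomputable def dilationBump (N n : ℕ) : ContDiffBump (0 : Pt N) where
  rIn := 1 / (4 * (n + 2))
  rOut := 1 / (2 * (n + 2))
  rIn_pos := by positivity
  rIn_lt_rOut := by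
    refine one_div_lt_one_div_of_lt (by positivity) ?_
    linarith [(Nat.cast_nonneg n : (0 : ℝ) ≤ n)]

theorem rOut_dilationBump (N n : ℕ) : (dilationBump N n).rOut = (1 - dilation n) / 2 := by
  simp only [dilationBump, dilation]
  field_simp
  ring

/-- A sequence of normalized kernels concentrating at the origin. -/
noncomputable def mollifier (N n : ℕ) : ScaleKernel N (dilation n) where
  toFun := (dilationBump N n).normed volume
  contDiff := (dilationBump N n).contDiff_normed
  tsupport_subset := by rw [ContDiffBump.tsupport_normed_eq, rOut_dilationBump]
  pos := dilation_pos n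

theorem isNormalized_mollifier (N n : ℕ) : (mollifier N n).IsNormalized where
  nonneg _ := (dilationBump N n).nonneg_normed _
  integral_eq_one := (dilationBump N n).integral_normed

variable {N k : ℕ} {F : Type*} [NormedAddCommGroup F] [NormedSpace ℝ F]

theorem tendsto_inv_dilation_pow (d : ℕ) :
    Tendsto (fun n => ENNReal.ofReal |(dilation n ^ d)⁻¹|) atTop (𝓝 1) := by
  have := ((tendsto_dilation.pow d).inv₀ (by simp)).abs
  simpa using ENNReal.tendsto_ofReal this

theorem setIntegral_mollifier_eq_convolution (n : ℕ) (g : Pt N → F) {x : Pt N} (hx : x ∈ cube N) :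
    ∫ y in (cube N : Set (Pt N)), (mollifier N n).toFun (y - dilation n • x) • g y =
      ((dilationBump N n).normed volume ⋆[ContinuousLinearMap.lsmul ℝ ℝ, volume] g)
        (dilation n • x) := by
  rw [setIntegral_eq_integral_of_forall_compl_eq_zero, convolution_eq_swap]
  · congr 1 with y
    rw [← neg_sub (dilation n • x) y]
    simp only [mollifier, ContDiffBump.normed_neg, ContinuousLinearMap.lsmul_apply]
  · intro y hy
    by_contra h
    refine hy ?_
    have := ScaleKernel.add_mem_cube (dilation_pos n) hx
      ((mollifier N n).tsupport_subset (subset_tsupport _ (left_ne_zero_of_smul h)))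
    simpa using this

variable [CompleteSpace F]

/-- Uniform continuity controls two errors: averaging around `s x` at radius `(1 - s) / 2`, and
moving from `s x` to `x`, at distance at most `(1 - s) √N`. The cube has finite volume, so a uniform
bound suffices. -/
theorem tendsto_conv_toLp {g : Pt N → F} (hg : Continuous g) (hc : HasCompactSupport g)
    (hL : MemLp g 1 (volQ N)) :
    Tendsto (fun n => (mollifier N n).conv (hL.toLp g)) atTop (𝓝 (hL.toLp g)) := by
  have huc := hc.uniformContinuous_of_continuous hg
  have key : ∀ ε > 0, ∀ᶠ n in atTop,
      ‖(mollifier N n).conv (hL.toLp g) - hL.toLp g‖ ≤ (volQ N).real Set.univ * (ε + ε) := by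
    intro ε hε
    obtain ⟨δ, hδ, h⟩ := Metric.uniformContinuous_iff.1 huc ε hε
    have h1 : Tendsto (fun n => 1 - dilation n) atTop (𝓝 0) := by
      simpa using tendsto_dilation.const_sub 1
    have h2 : Tendsto (fun n => (1 - dilation n) * √N) atTop (𝓝 0) := by
      simpa using h1.mul_const (√N)
    filter_upwards [h1.eventually_lt_const hδ, h2.eventually_lt_const hδ] with n hn1 hn2
    have hb := Lp.norm_le_of_ae_bound (f := (mollifier N n).conv (hL.toLp g) - hL.toLp g)
      (C := ε + ε) (by positivity) ?_
    · simpa [measureUnivNNReal, Measure.real, ENNReal.coe_toNNReal_eq_toReal] using hb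
    filter_upwards [Lp.coeFn_sub ((mollifier N n).conv (hL.toLp g)) (hL.toLp g), hL.coeFn_toLp,
      (mollifier N n).coeFn_conv (hL.toLp g), ae_restrict_mem (cube N).isOpen.measurableSet]
      with x hx1 hx2 hx3 hx4
    rw [hx1, Pi.sub_apply, hx2, hx3, ← dist_eq_norm]
    have hcongr : ∫ y in (cube N : Set (Pt N)),
        (mollifier N n).toFun (y - dilation n • x) • hL.toLp g y =
        ∫ y in (cube N : Set (Pt N)), (mollifier N n).toFun (y - dilation n • x) • g y := by
      refine integral_congr_ae ?_
      filter_upwards [hL.coeFn_toLp] with y hy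
      rw [hy]
    rw [hcongr, setIntegral_mollifier_eq_convolution n g hx4]
    refine (dist_triangle _ (g (dilation n • x)) _).trans (add_le_add ?_ ?_)
    · refine ContDiffBump.dist_normed_convolution_le hg.aestronglyMeasurable fun y hy => ?_
      refine (h ((Metric.mem_ball.1 hy).trans_le ?_)).le
      rw [rOut_dilationBump]
      linarith [dilation_le_one n]
    · refine (h ?_).le
      have : dilation n • x - x = -((1 - dilation n) • x) := by
        rw [sub_smul, one_smul]; abel
      rw [dist_eq_norm, this, norm_neg, norm_smul, Real.norm_of_nonneg
        (sub_nonneg.2 (dilation_le_one n))]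
      exact (mul_le_mul_of_nonneg_left (norm_le_of_mem_cube hx4)
        (sub_nonneg.2 (dilation_le_one n))).trans_lt hn2
  rw [Metric.tendsto_atTop']
  intro ε hε
  set V := (volQ N).real Set.univ
  have hV : 0 ≤ V := measureReal_nonneg
  obtain ⟨n₀, hn₀⟩ := eventually_atTop.1 (key (ε / (4 * (V + 1))) (by positivity))
  refine ⟨n₀, fun n hn => ?_⟩
  rw [dist_eq_norm]
  refine (hn₀ n hn.le).trans_lt ?_
  rw [← two_mul, ← mul_assoc, mul_div_assoc', div_lt_iff₀ (by positivity)]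
  nlinarith

theorem tendsto_conv (f : L1Q N F) :
    Tendsto (fun n => (mollifier N n).conv f) atTop (𝓝 f) := by
  rw [tendsto_iff_edist_tendsto_0]
  refine ENNReal.tendsto_nhds_zero.2 fun ε hε => ?_
  -- Four quarters: the averaging operator eventually has norm at most 2, so approximating `f` by
  -- `G` costs two before and one after the averaging of `G`.
  have hε4 : ε / 4 ≠ 0 := (ENNReal.div_pos hε.ne' (by simp)).ne'
  obtain ⟨g, hc, hfg, hg, hL⟩ :=
    (Lp.memLp f).exists_hasCompactSupport_eLpNorm_sub_le ENNReal.one_ne_top hε4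
  set G := hL.toLp g
  have hfG : ‖f - G‖ₑ ≤ ε / 4 := by
    refine le_of_eq_of_le ?_ hfg
    rw [Lp.enorm_def]
    refine eLpNorm_congr_ae ?_
    filter_upwards [Lp.coeFn_sub f G, hL.coeFn_toLp] with x hx1 hx2
    rw [hx1, Pi.sub_apply, Pi.sub_apply, hx2]
  have hG := tendsto_iff_edist_tendsto_0.1 (tendsto_conv_toLp hg hc hL)
  filter_upwards [ENNReal.tendsto_nhds_zero.1 hG (ε / 4) (pos_iff_ne_zero.2 hε4),
    (tendsto_inv_dilation_pow (Module.finrank ℝ (Pt N))).eventually_le_const ENNReal.one_lt_two]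
    with n hn1 hn2
  have h1 : edist ((mollifier N n).conv f) ((mollifier N n).conv G) ≤ 2 * (ε / 4) := by
    rw [edist_eq_enorm_sub, ← ScaleKernel.conv_sub]
    exact ((isNormalized_mollifier N n).enorm_conv_le _).trans (mul_le_mul' hn2 hfG)
  have h2 : edist G f ≤ ε / 4 := by
    rw [edist_comm, edist_eq_enorm_sub]
    exact hfG
  calc edist ((mollifier N n).conv f) f ≤ edist ((mollifier N n).conv f) ((mollifier N n).conv G) +
        edist ((mollifier N n).conv G) G + edist G f := edist_triangle4 _ _ _ _
    _ ≤ 2 * (ε / 4) + ε / 4 + ε / 4 := add_le_add (add_le_add h1 hn1) h2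
    _ = 4 * (ε / 4) := by ring
    _ = ε := ENNReal.mul_div_cancel (by simp) (by simp)

/-! ### Recovery sequences and the upper bound -/

section Recovery

theorem extZero_conv (m : ℕ) (v : FieldTuple N k) (l : ℕ) :
    FieldTuple.extZero (fun i => (mollifier N m).conv (v i) : FieldTuple N k) l =
      (mollifier N m).conv (FieldTuple.extZero v l) := by
  unfold FieldTuple.extZero
  split
  · rfl
  · rw [ScaleKernel.conv_zero]

theorem memBVOp_conv {l : ℕ} (m : ℕ) (B : FirstOrderOp N l) (f : L1Q N (Tens N l)) :
    MemBVOp B ((mollifier N m).conv f) := by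
  rw [MemBVOp, ScaleKernel.applyL1_conv]
  exact isBoundedMeasure_toDistr _

/-- Each term of the smoothed energy has a majorant tending to the original term. In the first one
`Du` is left unsmoothed, and the error is the `L¹` distance from `v_0` to its average; the others
use `measureNorm_defect_le`. -/
theorem exists_conv_energy_lt {α : Fin (k + 1) → ℝ} {B : OpTuple N k} {u : L1Q N ℝ}
    {v : FieldTuple N k} (hv : ∀ l, MemBVOp (B l) (v l)) {a : ℝ≥0∞} (ha : energy α B u v < a) :
    ∃ m, energy α B u (fun i => (mollifier N m).conv (v i)) < a := by
  have h0 : Tendsto (fun m => ENNReal.ofReal (α 0) *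
      (measureNorm (grad N (toDistr u) - toDistr (FieldTuple.extZero v 0)) +
        ‖FieldTuple.extZero v 0 - (mollifier N m).conv (FieldTuple.extZero v 0)‖ₑ)) atTop
      (𝓝 (ENNReal.ofReal (α 0) *
        measureNorm (grad N (toDistr u) - toDistr (FieldTuple.extZero v 0)))) := by
    refine ENNReal.Tendsto.const_mul ?_ (Or.inr ENNReal.ofReal_ne_top)
    have h1 := ((tendsto_conv (FieldTuple.extZero v 0)).const_sub (FieldTuple.extZero v 0)).enorm
    rw [sub_self, enorm_zero] at h1
    simpa using h1.const_add
      (measureNorm (grad N (toDistr u) - toDistr (FieldTuple.extZero v 0)))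
  have hl : ∀ l : Fin k, Tendsto (fun m => ENNReal.ofReal (α l.succ) *
      (ENNReal.ofReal (1 - dilation m) * ‖(mollifier N m).conv (FieldTuple.extZero v (l + 1))‖ₑ +
        ENNReal.ofReal (dilation m) *
          (ENNReal.ofReal |(dilation m ^ Module.finrank ℝ (Pt N))⁻¹| *
            measureNorm (toDistr (FieldTuple.extZero v (l + 1)) - applyL1 (B l) (v l))))) atTop
      (𝓝 (ENNReal.ofReal (α l.succ) *
        measureNorm (toDistr (FieldTuple.extZero v (l + 1)) - applyL1 (B l) (v l)))) := by
    intro l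
    refine ENNReal.Tendsto.const_mul ?_ (Or.inr ENNReal.ofReal_ne_top)
    have hM := ((isBoundedMeasure_toDistr (FieldTuple.extZero v (l + 1))).sub
      (hv l)).measureNorm_ne_top
    have h1 : Tendsto (fun n => ENNReal.ofReal (1 - dilation n)) atTop (𝓝 0) := by
      simpa using ENNReal.tendsto_ofReal (tendsto_dilation.const_sub 1)
    have h2 : Tendsto (fun n => ENNReal.ofReal (dilation n)) atTop (𝓝 1) := by
      simpa using ENNReal.tendsto_ofReal tendsto_dilation
    have h3 := ENNReal.Tendsto.mul h1 (Or.inr enorm_ne_top)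
      (tendsto_conv (FieldTuple.extZero v (l + 1))).enorm (Or.inr ENNReal.zero_ne_top)
    have h4 := ENNReal.Tendsto.mul_const (tendsto_inv_dilation_pow (Module.finrank ℝ (Pt N)))
      (Or.inr hM)
    have h5 := ENNReal.Tendsto.mul h2 (Or.inr (by simpa using hM)) h4 (Or.inr ENNReal.one_ne_top)
    simpa using h3.add h5
  have hsum := h0.add (tendsto_finsetSum Finset.univ fun l _ => hl l)
  obtain ⟨m, hm⟩ := (hsum.eventually_lt_const ha).exists
  refine ⟨m, lt_of_le_of_lt ?_ hm⟩
  rw [energy, extZero_conv]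
  refine add_le_add ?_ (Finset.sum_le_sum fun l _ => ?_)
  · gcongr
    have := measureNorm_add_le (grad N (toDistr u) - toDistr (FieldTuple.extZero v 0))
      (toDistr (FieldTuple.extZero v 0 - (mollifier N m).conv (FieldTuple.extZero v 0)))
    rw [measureNorm_toDistr, map_sub] at this
    refine le_of_eq_of_le (congrArg _ ?_) this
    exact (sub_add_sub_cancel _ _ _).symm
  · rw [extZero_conv]
    gcongr
    exact (isNormalized_mollifier N m).measureNorm_defect_le (dilation_le_one m) _ _ _

/-- The smoothing index `m` is chosen first and kept fixed. Replacing `B` by `Bn n` then changes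
each defect by at most a constant times the coefficient distance. -/
theorem eventually_pgv_lt {Bn : ℕ → OpTuple N k} {B : OpTuple N k}
    {αn : ℕ → Fin (k + 1) → ℝ} {α : Fin (k + 1) → ℝ} {u : L1Q N ℝ} (hu : MemBV u)
    (hB : ∀ l, Tendsto (fun n => coeffNorm (Bn n l - B l)) atTop (𝓝 0))
    (hα : Tendsto αn atTop (𝓝 α)) {a : ℝ≥0∞} (ha : pgv α B u < a) :
    ∀ᶠ n in atTop, pgv (αn n) (Bn n) u < a := by
  obtain ⟨v, hv⟩ := iInf_lt_iff.1 ha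
  obtain ⟨hv, hva⟩ := iInf_lt_iff.1 hv
  obtain ⟨m, hm⟩ := exists_conv_energy_lt hv hva
  set w : FieldTuple N k := fun i => (mollifier N m).conv (v i) with hw
  choose C hC using fun l : Fin k =>
    (mollifier N m).exists_measureNorm_applyL1_conv_le (v l)
  have hα' : ∀ i, Tendsto (fun n => ENNReal.ofReal (αn n i)) atTop (𝓝 (ENNReal.ofReal (α i))) :=
    fun i => ENNReal.tendsto_ofReal (tendsto_pi_nhds.1 hα i)
  have h0 := ENNReal.Tendsto.mul_const (hα' 0)
    (Or.inr (hu.sub (isBoundedMeasure_toDistr (FieldTuple.extZero w 0))).measureNorm_ne_top)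
  have hl : ∀ l : Fin k, Tendsto (fun n => ENNReal.ofReal (αn n l.succ) *
      (measureNorm (toDistr (FieldTuple.extZero w (l + 1)) - applyL1 (B l) (w l)) +
        ENNReal.ofReal (coeffNorm (Bn n l - B l)) * C l)) atTop
      (𝓝 (ENNReal.ofReal (α l.succ) *
        measureNorm (toDistr (FieldTuple.extZero w (l + 1)) - applyL1 (B l) (w l)))) := by
    intro l
    have h1 : Tendsto (fun n => ENNReal.ofReal (coeffNorm (Bn n l - B l)) * (C l : ℝ≥0∞)) atTop
        (𝓝 0) := by
      simpa using ENNReal.Tendsto.mul_const (b := (C l : ℝ≥0∞)) (ENNReal.tendsto_ofReal (hB l))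
        (Or.inr ENNReal.coe_ne_top)
    have hM := ((isBoundedMeasure_toDistr (FieldTuple.extZero w (l + 1))).sub
      (memBVOp_conv m (B l) (v l))).measureNorm_ne_top
    have h2 := h1.const_add
      (measureNorm (toDistr (FieldTuple.extZero w (l + 1)) - applyL1 (B l) (w l)))
    rw [add_zero] at h2
    exact ENNReal.Tendsto.mul (hα' _) (Or.inr hM) h2 (Or.inr ENNReal.ofReal_ne_top)
  have hsum := h0.add (tendsto_finsetSum Finset.univ fun l _ => hl l)
  filter_upwards [hsum.eventually_lt_const hm] with n hn
  refine (iInf₂_le w fun l => memBVOp_conv m _ _).trans_lt (lt_of_le_of_lt ?_ hn)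
  rw [energy]
  refine add_le_add le_rfl (Finset.sum_le_sum fun l _ => ?_)
  gcongr
  have hsub := (memBVOp_conv m (Bn n l - B l) (v l)).measureNorm_sub_le
    (T := toDistr (FieldTuple.extZero w (l + 1)) - applyL1 (B l) (w l))
  have heq : applyL1 (Bn n l) (w l) = applyL1 (B l) (w l) + applyL1 (Bn n l - B l) (w l) := by
    rw [← applyL1_add, add_sub_cancel]
  rw [heq, ← sub_sub]
  exact hsub.trans (add_le_add le_rfl (hC l _))

end Recovery

/-- The zero tuple is admissible for every tuple of operators, and its energy is finite because `Du`
is a bounded measure. -/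
theorem pgv_ne_top (α : Fin (k + 1) → ℝ) (B : OpTuple N k) {u : L1Q N ℝ} (hu : MemBV u) :
    pgv α B u ≠ ⊤ := by
  have hmem : ∀ l, MemBVOp (B l) ((0 : FieldTuple N k) l) := fun l => by
    rw [MemBVOp, Pi.zero_apply, map_zero]
    simpa using isBoundedMeasure_toDistr (0 : L1Q N (Tens N (l + 1 + 1)))
  refine ne_top_of_le_ne_top ?_ (iInf₂_le 0 hmem)
  refine ENNReal.add_ne_top.2 ⟨ENNReal.mul_ne_top ENNReal.ofReal_ne_top
    (hu.sub (isBoundedMeasure_toDistr _)).measureNorm_ne_top, ENNReal.sum_ne_top.2 fun l _ =>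
      ENNReal.mul_ne_top ENNReal.ofReal_ne_top
        ((isBoundedMeasure_toDistr _).sub (hmem l)).measureNorm_ne_top⟩


end PGV

theorem proposition3p9 (N k : ℕ) (hN : 1 ≤ N) (hk : 1 ≤ k)
    (u : PGV.L1Q N ℝ) (hu : PGV.MemBV u)
    (Bn : ℕ → PGV.OpTuple N k) (B : PGV.OpTuple N k)
    (αn : ℕ → Fin (k + 1) → ℝ) (α : Fin (k + 1) → ℝ)
    (hBn : ∀ n l, PGV.MemPi (Bn n l))
    (hαn : ∀ n i, 0 < αn n i) (hα : ∀ i, 0 < α i)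
    (hB_lim : ∀ l, Filter.Tendsto (fun n => PGV.coeffNorm (Bn n l - B l)) Filter.atTop (nhds 0))
    (hα_lim : Filter.Tendsto αn Filter.atTop (nhds α))
    (hcomp : ∀ l, PGV.IsCompactCollection (Set.range fun n => Bn n l)) :
    (∀ n, PGV.pgv (αn n) (Bn n) u ≠ ⊤) ∧ PGV.pgv α B u ≠ ⊤ ∧
      Filter.Tendsto (fun n => PGV.pgv (αn n) (Bn n) u) Filter.atTop
        (nhds (PGV.pgv α B u)) := by
  refine ⟨fun n => PGV.pgv_ne_top _ _ hu, PGV.pgv_ne_top _ _ hu, tendsto_order.2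
    ⟨fun a ha => ?_, fun a ha => PGV.eventually_pgv_lt hu hB_lim hα_lim ha⟩⟩
  -- If the lower bound failed, infinitely many values would lie below an intermediate `b`.
  -- Competitors of energy at most `b` would produce in the limit a competitor for `B` of energy at
  -- most `b`, below the infimum.
  obtain ⟨b, hab, hb⟩ := exists_between ha
  by_contra hne
  have hfreq : ∃ᶠ n in Filter.atTop, PGV.pgv (αn n) (Bn n) u < b :=
    (Filter.not_eventually.1 hne).mono fun n hn => (not_lt.1 hn).trans_lt hab
  obtain ⟨φ, hφ, hlt⟩ := Filter.extraction_of_frequently_atTop hfreq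
  have hex : ∀ n, ∃ v : PGV.FieldTuple N k, (∀ l, PGV.MemBVOp (Bn (φ n) l) (v l)) ∧
      PGV.energy (αn (φ n)) (Bn (φ n)) u v ≤ b := fun n => by
    obtain ⟨v, hv⟩ := iInf_lt_iff.1 (hlt n)
    obtain ⟨hv, hvb⟩ := iInf_lt_iff.1 hv
    exact ⟨v, hv, hvb.le⟩
  choose v hv hvb using hex
  obtain ⟨v', hv', hE⟩ := PGV.exists_energy_le (fun n l => (hBn n l).2)
    (fun l => PGV.tendsto_of_coeffNorm (hB_lim l)) hαn hα hα_lim hcomp hu hφ.tendsto_atTop hv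
    hb.ne_top hvb
  exact hb.not_ge ((iInf₂_le v' hv').trans hE)
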